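/- Assume the Continuum Hypothesis. An ideal on a countably infinite set $\Lambda$ is a nonempty family $\mathcal I\subseteq\mathcal P(\Lambda)$ that is closed under subsets and finite unions, contains all finite subsets of $\Lambda$, and does not contain $\Lambda$. For ideals $\mathcal J$ on $\Gamma$ and $\mathcal I$ on $\Lambda$, write $\mathcal J\le_K\mathcal I$ if there is $\phi:\Lambda\to\Gamma$ with $\phi[A]\notin\mathcal J$ for every $A\notin\mathcal I$. Let $\mathrm{Fin}^2$ be the ideal of those $C\subseteq\omega^2$ for which $\{k:(n,k)\in C\}$ is infinite for only finitely many $n$, and let $$\mathcal{BI}=\{A\subseteq\omega^3:\ \exists k\ [\forall i<k\ (A_{(i)}\in\mathrm{Fin}^2)\ \wedge\ \forall i\ge k\ (A_{(i)}\text{ is finite})]\},\qquad A_{(i)}=\{(x,y):(i,x,y)\in A\}.$$ A topological space $X$ is in $\mathrm{FinBW}(\mathcal I)$ if for every $f:\Lambda\to X$ there is $A\subseteq\Lambda$, $A\notin\mathcal I$, such that $f\restriction A$ converges, i.e. for some $x\in X$ every neighbourhood $U$ of $x$ contains $f(\lambda)$ for all but finitely many $\lambda\in A$. For infinite $D\subseteq\omega$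 let $\mathrm{FS}(D)$ be the set of sums of finitely many (at least one) distinct elements of $D$, let $r(D)=[D]^2$ be the set of unordered pairs of distinct elements of $D$, and let $\Delta(D)=\{a-b:a,b\in D,\ a>b\}$. A space $X$ is Hindman (resp. Ramsey, resp. differentially compact) if, for $\rho=\mathrm{FS}$ (resp. $\rho=r$, resp. $\rho=\Delta$), every function $f$ from $\omega$ (resp. $[\omega]^2$, resp. $\omega$) to $X$ admits an infinite $D\subseteq\omega$ and a point $x\in X$ such that for every neighbourhood $U$ of $x$ there is a finite $K\subseteq\omega$ with $f[\rho(D\setminus K)]\subseteq U$. For an infinite almost disjoint family $\mathcal A$ on $\omega$ (infinite subsets of $\omega$ with pairwise finite intersections), $\Psi(\mathcal A)=\omega\cup\mathcal A$ carries the topology in which the points of $\omega$ are isolated and the basic neighbourhoods of $A\in\mathcal A$ are the sets $\{A\}\cup(A\setminus F)$ with $F$ finite, and $\Phi(\mathcal A)$ is the Alexandroff one-point compactification of $\Psi(\mathcal A)$. Then, for every ideal $\mathcal I$ on a countably infinite set, the following are equivalent: 1. $\mathcal{BI}\not\le_K\mathcal I$; 2. there is a Hausdorff space in $\mathrm{FinBW}(\mathcal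 I)$ that is not Hindman (resp. not Ramsey, resp. not differentially compact). Moreover, if $\mathcal{BI}\not\le_K\mathcal I$, then there is an infinite maximal almost disjoint family $\mathcal A$ on $\omega$ such that $\Phi(\mathcal A)$ is Hausdorff, compact, separable, of cardinality $\mathfrak c$, belongs to $\mathrm{FinBW}(\mathcal I)$, and is neither Hindman, nor Ramsey, nor differentially compact. -/

import Mathlib

open Filter Topology

universe u v

/-- `I` is an ideal on the set `Λ`: a nonempty family of subsets of `Λ`, closed under subsets and
finite unions, containing all finite subsets of `Λ` and not containing `Λ`. -/
structure IsIdealOn {Λ : Type u} (I : Set (Set Λ)) : Prop where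
  nonempty : I.Nonempty
  subset_mem : ∀ A B : Set Λ, A ∈ I → B ⊆ A → B ∈ I
  union_mem : ∀ A B : Set Λ, A ∈ I → B ∈ I → A ∪ B ∈ I
  finite_mem : ∀ A : Set Λ, A.Finite → A ∈ I
  univ_notMem : Set.univ ∉ I

/-- The Katětov order `J ≤_K I`, for `J` on `Γ` and `I` on `Λ`: some `φ : Λ → Γ` maps
`I`-positive sets to `J`-positive sets. -/
def KatetovLE {Γ : Type v} {Λ : Type u} (J : Set (Set Γ)) (I : Set (Set Λ)) : Prop :=
  ∃ φ : Λ → Γ, ∀ A : Set Λ, A ∉ I → φ '' A ∉ J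

/-- The ideal `Fin²` on `ω²`: all but finitely many vertical sections are finite. -/
def FinSq : Set (Set (ℕ × ℕ)) :=
  {C | {n : ℕ | ¬ {k : ℕ | (n, k) ∈ C}.Finite}.Finite}

/-- The section `A_(i) = {(x, y) : (i, x, y) ∈ A}` of `A ⊆ ω³`. -/
def sectionAt (A : Set (ℕ × ℕ × ℕ)) (i : ℕ) : Set (ℕ × ℕ) :=
  {p | (i, p.1, p.2) ∈ A}

/-- The ideal `𝓑𝓘` on `ω³`. -/
def BI : Set (Set (ℕ × ℕ × ℕ)) :=
  {A | ∃ k : ℕ, (∀ i < k, sectionAt A i ∈ FinSq) ∧ (∀ i ≥ k, (sectionAt A i).Finite)}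

/-- `X ∈ FinBW(I)`: for every `f : Λ → X` there is `A ∉ I` such that `f ↾ A` converges. -/
def FinBW {Λ : Type u} (I : Set (Set Λ)) (X : Type v) [TopologicalSpace X] : Prop :=
  ∀ f : Λ → X, ∃ A : Set Λ, A ∉ I ∧ ∃ x : X, Tendsto (A.domRestrict f) cofinite (𝓝 x)

/-- For an operation `ρ` from infinite subsets of `ω` to subsets of `Λ`, and `F` infinite:
`f ↾ ρ(F)` is `ρ`-convergent to `x`. -/
def RhoConverges {Λ : Type u} {X : Type v} [TopologicalSpace X]
    (ρ : Set ℕ → Set Λ) (F : Set ℕ) (f : Λ → X) (x : X) : Prop :=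
  ∀ U ∈ 𝓝 x, ∃ K : Set ℕ, K.Finite ∧ f '' ρ (F \ K) ⊆ U

/-- `X ∈ FinBW(ρ)`, for an operation `ρ` defined on the infinite subsets of `ω`. -/
def FinBWRho {Λ : Type u} (ρ : Set ℕ → Set Λ) (X : Type v) [TopologicalSpace X] : Prop :=
  ∀ f : Λ → X, ∃ F : Set ℕ, F.Infinite ∧ ∃ x : X, RhoConverges ρ F f x

/-- `FS(D)`: all sums of finitely many (at least one) distinct elements of `D`. -/
def finiteSums (D : Set ℕ) : Set ℕ :=
  {n | ∃ s : Finset ℕ, s.Nonempty ∧ (s : Set ℕ) ⊆ D ∧ n = ∑ i ∈ s, i}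

/-- `[ω]²`, the set of all unordered pairs of distinct natural numbers. -/
abbrev NatPair : Type := {e : Finset ℕ // e.card = 2}

/-- `r(H) = [H]²`, the set of all unordered pairs of distinct elements of `H`. -/
def pairsOf (H : Set ℕ) : Set NatPair :=
  {e | (e.1 : Set ℕ) ⊆ H}

/-- `Δ(E)`: all positive differences of elements of `E`. -/
def posDiffs (E : Set ℕ) : Set ℕ :=
  {d | ∃ a ∈ E, ∃ b ∈ E, b < a ∧ d = a - b}

/-- Hindman spaces. -/
def HindmanSpace (X : Type v) [TopologicalSpace X] : Prop := FinBWRho finiteSums X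

/-- Ramsey spaces. -/
def RamseySpace (X : Type v) [TopologicalSpace X] : Prop := FinBWRho pairsOf X

/-- Differentially compact spaces. -/
def DiffCompactSpace (X : Type v) [TopologicalSpace X] : Prop := FinBWRho posDiffs X

/-- Almost disjoint families on a countably infinite set (where "of the same cardinality as `Λ`"
means infinite and "of smaller cardinality than `Λ`" means finite). -/
def IsAlmostDisjointFamily {Λ : Type u} (𝒜 : Set (Set Λ)) : Prop :=
  (∀ A ∈ 𝒜, A.Infinite) ∧ ∀ A ∈ 𝒜, ∀ B ∈ 𝒜, A ≠ B → (A ∩ B).Finite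

/-- Maximal (with respect to inclusion) almost disjoint families. -/
def IsMADFamily {Λ : Type u} (𝒜 : Set (Set Λ)) : Prop :=
  Maximal IsAlmostDisjointFamily 𝒜

/-- The underlying set `Λ ∪ 𝒜` of the Mrówka space `Ψ(𝒜)`. -/
inductive MrowkaSpace {Λ : Type u} (𝒜 : Set (Set Λ)) : Type u
  | point (n : Λ) : MrowkaSpace 𝒜
  | member (A : 𝒜) : MrowkaSpace 𝒜

/-- The topology of `Ψ(𝒜)`: points of `Λ` are isolated, and basic neighbourhoods of `A ∈ 𝒜` are
the sets `{A} ∪ (A \ F)` with `F` finite. So `U` is open iff it contains all but finitely many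
points of each `A ∈ 𝒜` that belongs to `U`. -/
instance MrowkaSpace.instTopologicalSpace {Λ : Type u} (𝒜 : Set (Set Λ)) :
    TopologicalSpace (MrowkaSpace 𝒜) where
  IsOpen U := ∀ A : 𝒜, MrowkaSpace.member A ∈ U →
    ∃ F : Set Λ, F.Finite ∧ ∀ n ∈ (A : Set Λ) \ F, MrowkaSpace.point n ∈ U
  isOpen_univ := fun _ _ => ⟨∅, Set.finite_empty, fun _ _ => Set.mem_univ _⟩
  isOpen_inter := by
    intro U V hU hV A hA
    obtain ⟨F, hF, h1⟩ := hU A hA.1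
    obtain ⟨G, hG, h2⟩ := hV A hA.2
    exact ⟨F ∪ G, hF.union hG, fun n hn =>
      ⟨h1 n ⟨hn.1, fun h => hn.2 (Or.inl h)⟩, h2 n ⟨hn.1, fun h => hn.2 (Or.inr h)⟩⟩⟩
  isOpen_sUnion := by
    intro S hS A hA
    obtain ⟨U, hU, hAU⟩ := hA
    obtain ⟨F, hF, h⟩ := hS U hU A hAU
    exact ⟨F, hF, fun n hn => ⟨U, hU, h n hn⟩⟩

/-- `Φ(𝒜)`, the Alexandroff one-point compactification of `Ψ(𝒜)`. -/
abbrev FranklinSpace {Λ : Type u} (𝒜 : Set (Set Λ)) : Type u := OnePoint (MrowkaSpace 𝒜)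

/-!
Suppose that a Hausdorff space in `FinBW(𝓑𝓘)` contained infinitely many distinct limits `p i` of
injective sequences `q i`. Dropping finitely many terms of each `q i`, we may assume that every
point occurs in only finitely many of them, and then `(i, x, y) ↦ q i x` converges on no
`𝓑𝓘`-positive set. So the finitely many limits of injective sequences have only cofinite
neighbourhoods, and the image of any ultrafilter under a map `f` from a countable set is finer than
a countably generated filter that converges. Along a suitable ultrafilter (an iterated
nonprincipal one for pairs, an idempotent one for finite sums) a decreasing sequence of large sets
is diagonalized by some `ρ(F)`, and `f ↾ ρ(F)` converges.

Conversely, let `𝓑𝓘 ≰_K 𝓘`. Given a countable almost disjoint family covering `ω`, let `r m` be the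
index of its first member that contains `m`. The map `l ↦ (r (f l), f l, l)` sends an `𝓘`-positive
set to a member of `𝓑𝓘`, which says that, on a smaller positive set, `f` is finite-to-one with image
either inside one member or almost disjoint from all of them; in the second case the image is added
to the family. Under CH all maps `f` are handled in `ω₁` steps. The family starts from the classes
of numbers of equal 2-adic valuation: every `Δ(F)` meets one of them in an infinite set and is
contained in none, so no member of the final family contains any `Δ(F)`. As `Δ` is
Katětov below `FS` and `r`, `Φ(𝒜)` is then neither Hindman nor Ramsey.
-/

section Convergence

variable {α β : Type*} {A : Set α} {f : α → β} {l : Filter β}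

theorem tendsto_domRestrict_cofinite_iff :
    Tendsto (A.domRestrict f) cofinite l ↔ ∀ U ∈ l, {a ∈ A | f a ∉ U}.Finite := by
  rw [tendsto_def]
  refine forall₂_congr fun U _ => ?_
  rw [mem_cofinite, ← Set.finite_image_iff (f := Subtype.val) Subtype.val_injective.injOn]
  refine iff_of_eq (congrArg _ ?_)
  ext a
  by_cases ha : a ∈ A <;> simp [ha]

theorem tendsto_domRestrict_mono {B : Set α} (h : Tendsto (A.domRestrict f) cofinite l)
    (hBA : B ⊆ A) : Tendsto (B.domRestrict f) cofinite l :=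
  h.comp (Set.inclusion_injective hBA).tendsto_cofinite

theorem tendsto_domRestrict_cofinite_cofinite (hfib : ∀ y, (A ∩ f ⁻¹' {y}).Finite) :
    Tendsto (A.domRestrict f) cofinite cofinite :=
  .cofinite_of_finite_preimage_singleton fun y =>
    ((hfib y).preimage Subtype.val_injective.injOn).subset fun a ha => ⟨a.2, ha⟩

theorem infinite_image_of_tendsto_cofinite (hA : A.Infinite)
    (h : Tendsto (A.domRestrict f) cofinite cofinite) : (f '' A).Infinite := fun hfin =>
  hA <| (tendsto_domRestrict_cofinite_iff.1 h _ hfin.compl_mem_cofinite).subset fun a ha =>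
    ⟨ha, fun hfa => hfa ⟨a, ha, rfl⟩⟩

theorem eq_of_tendsto_of_infinite_fibre [TopologicalSpace β] [T1Space β] {x y : β}
    (h : Tendsto (A.domRestrict f) cofinite (𝓝 x)) (hy : (A ∩ f ⁻¹' {y}).Infinite) : y = x := by
  by_contra hne
  refine hy ((tendsto_domRestrict_cofinite_iff.1 h {y}ᶜ
    (isOpen_compl_singleton.mem_nhds fun h => hne h.symm)).subset fun a ha => ⟨ha.1, ?_⟩)
  exact fun h => h ha.2

theorem tendsto_natEmbedding (hA : A.Infinite) (h : Tendsto (A.domRestrict f) cofinite l) :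
    Tendsto (fun n => f (hA.natEmbedding A n)) atTop l := by
  rw [← Nat.cofinite_eq_atTop]
  exact h.comp (hA.natEmbedding A).injective.tendsto_cofinite

end Convergence

section Transfer

variable {Λ : Type u} {X : Type v} [TopologicalSpace X]

theorem FinBW.of_katetovLE {Γ : Type*} {J : Set (Set Γ)} {I : Set (Set Λ)} (hJI : KatetovLE J I)
    (hX : FinBW I X) : FinBW J X := by
  intro f
  obtain ⟨φ, hφ⟩ := hJI
  obtain ⟨A, hA, x, hx⟩ := hX (f ∘ φ)
  refine ⟨φ '' A, hφ A hA, x, ?_⟩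
  rw [tendsto_domRestrict_cofinite_iff] at hx ⊢
  intro U hU
  refine ((hx U hU).image φ).subset ?_
  rintro _ ⟨⟨a, ha, rfl⟩, haU⟩
  exact ⟨a, ⟨ha, haU⟩, rfl⟩

theorem FinBW.homeomorph {Y : Type*} [TopologicalSpace Y] {I : Set (Set Λ)} (e : X ≃ₜ Y)
    (hX : FinBW I X) : FinBW I Y := by
  intro f
  obtain ⟨A, hA, x, hx⟩ := hX (e.symm ∘ f)
  refine ⟨A, hA, e x, ?_⟩
  convert (e.continuous.tendsto x).comp hx using 1
  ext a
  simp

theorem FinBWRho.homeomorph {Y : Type*} [TopologicalSpace Y] {ρ : Set ℕ → Set Λ} (e : X ≃ₜ Y)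
    (hX : FinBWRho ρ X) : FinBWRho ρ Y := by
  intro f
  obtain ⟨F, hF, x, hx⟩ := hX (e.symm ∘ f)
  refine ⟨F, hF, e x, fun U hU => ?_⟩
  obtain ⟨K, hK, hKU⟩ := hx (e ⁻¹' U) (e.continuous.continuousAt hU)
  refine ⟨K, hK, ?_⟩
  rintro _ ⟨a, ha, rfl⟩
  simpa using hKU ⟨a, ha, rfl⟩

/-- The Katětov order between operations `ρ`, `ρ'` on infinite subsets of `ω`: some `φ` such that
every infinite `F` has an infinite `E` whose tails satisfy `ρ' (E \ L) ⊆ φ '' ρ (F \ K)`. -/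
def RhoKatetovLE {Γ : Type*} (ρ' : Set ℕ → Set Γ) (ρ : Set ℕ → Set Λ) : Prop :=
  ∃ φ : Λ → Γ, ∀ F : Set ℕ, F.Infinite → ∃ E : Set ℕ, E.Infinite ∧
    ∀ K : Set ℕ, K.Finite → ∃ L : Set ℕ, L.Finite ∧ ρ' (E \ L) ⊆ φ '' ρ (F \ K)

theorem FinBWRho.of_rhoKatetovLE {Γ : Type*} {ρ' : Set ℕ → Set Γ} {ρ : Set ℕ → Set Λ}
    (h : RhoKatetovLE ρ' ρ) (hX : FinBWRho ρ X) : FinBWRho ρ' X := by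
  intro f
  obtain ⟨φ, hφ⟩ := h
  obtain ⟨F, hF, x, hx⟩ := hX (f ∘ φ)
  obtain ⟨E, hE, hEF⟩ := hφ F hF
  refine ⟨E, hE, x, fun U hU => ?_⟩
  obtain ⟨K, hK, hKU⟩ := hx U hU
  obtain ⟨L, hL, hLK⟩ := hEF K hK
  refine ⟨L, hL, (Set.image_mono hLK).trans ?_⟩
  rwa [← Set.image_comp]

theorem rhoKatetovLE_posDiffs_pairsOf : RhoKatetovLE posDiffs pairsOf := by
  have nonempty (e : NatPair) : e.1.Nonempty := Finset.card_pos.1 (two_pos.trans_eq e.2.symm)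
  refine ⟨fun e => e.1.max' (nonempty e) - e.1.min' (nonempty e), fun F hF =>
    ⟨F, hF, fun K hK => ⟨K, hK, ?_⟩⟩⟩
  rintro _ ⟨a, ha, b, hb, hba, rfl⟩
  refine ⟨⟨{b, a}, Finset.card_pair hba.ne⟩, ?_, ?_⟩
  · change (({b, a} : Finset ℕ) : Set ℕ) ⊆ F \ K
    exact (Finset.coe_pair (a := b) (b := a)).trans_subset (Set.pair_subset hb ha)
  · simp [Finset.max'_insert, Finset.min'_insert, hba.le]

theorem sum_Ico_mem_finiteSums {D : Set ℕ} {d : ℕ → ℕ} (hd : d.Injective) {m n : ℕ} (hmn : m < n)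
    (hD : ∀ i ≥ m, d i ∈ D) : ∑ i ∈ Finset.Ico m n, d i ∈ finiteSums D := by
  refine ⟨(Finset.Ico m n).image d, by simpa using hmn, ?_, ?_⟩
  · rw [Finset.coe_image, Set.image_subset_iff]
    exact fun i hi => hD i (Finset.mem_Ico.1 hi).1
  · exact (Finset.sum_image (f := id) hd.injOn).symm

theorem rhoKatetovLE_posDiffs_finiteSums : RhoKatetovLE posDiffs finiteSums := by
  refine ⟨id, fun D hD => ?_⟩
  let d := Nat.nth (· ∈ D)
  have hd : StrictMono d := Nat.nth_strictMono hD
  let e : ℕ → ℕ := fun n => ∑ i ∈ Finset.range n, d (i + 1)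
  have he : StrictMono e := strictMono_nat_of_lt_succ fun n => by
    simpa only [e, Finset.sum_range_succ] using
      Nat.lt_add_of_pos_right (Nat.zero_le _ |>.trans_lt (hd n.lt_succ_self))
  refine ⟨Set.range e, Set.infinite_range_of_injective he.injective, fun K hK => ?_⟩
  obtain ⟨N, hN⟩ : ∃ N, ∀ i ≥ N, d (i + 1) ∉ K := by
    have htends := (hd.injective.comp (add_left_injective 1)).tendsto_cofinite
    rw [Nat.cofinite_eq_atTop] at htends
    exact eventually_atTop.1 (htends.eventually
      (hK.eventually_cofinite_notMem.filter_mono Nat.cofinite_eq_atTop.ge))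
  refine ⟨e '' Set.Iio N, (Set.finite_Iio N).image e, ?_⟩
  rw [Set.range_sdiff_image he.injective, Set.image_id]
  rintro _ ⟨_, ⟨n, -, rfl⟩, _, ⟨m, hm, rfl⟩, hmn, rfl⟩
  replace hmn : m < n := he.lt_iff_lt.1 hmn
  replace hm : N ≤ m := not_lt.1 hm
  have hsum : e n - e m = ∑ i ∈ Finset.Ico m n, d (i + 1) := by
    simp only [e, ← Finset.sum_range_add_sum_Ico _ hmn.le, Nat.add_sub_cancel_left]
  rw [hsum]
  refine sum_Ico_mem_finiteSums (hd.injective.comp (add_left_injective 1)) hmn fun i hi => ?_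
  exact ⟨Nat.nth_mem_of_infinite hD _, hN i (hm.trans hi)⟩

theorem RamseySpace.diffCompactSpace (hX : RamseySpace X) : DiffCompactSpace X :=
  FinBWRho.of_rhoKatetovLE rhoKatetovLE_posDiffs_pairsOf hX

theorem HindmanSpace.diffCompactSpace (hX : HindmanSpace X) : DiffCompactSpace X :=
  FinBWRho.of_rhoKatetovLE rhoKatetovLE_posDiffs_finiteSums hX

end Transfer

section BI

theorem infinite_of_notMem_BI {A : Set (ℕ × ℕ × ℕ)} (hA : A ∉ BI) : A.Infinite := by
  refine fun hfin => hA ⟨0, by simp, fun i _ => ?_⟩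
  exact hfin.preimage (f := fun p : ℕ × ℕ => (i, p)) (Prod.mk_right_injective i).injOn

theorem mem_BI_of_subset {A B : Set (ℕ × ℕ × ℕ)} (hB : B ∈ BI) (h : A ⊆ B) : A ∈ BI := by
  obtain ⟨k, hlt, hge⟩ := hB
  refine ⟨k, fun i hi => ?_, fun i hi => (hge i hi).subset fun p hp => h hp⟩
  exact (hlt i hi).subset fun n hn hf => hn (hf.subset fun k hk => h hk)

theorem exists_infinite_sectionAt_of_notMem_BI {A : Set (ℕ × ℕ × ℕ)} (hA : A ∉ BI)
    (hsec : ∀ i, sectionAt A i ∈ FinSq) (k : ℕ) : ∃ i ≥ k, (sectionAt A i).Infinite := by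
  by_contra! hfin
  exact hA ⟨k, fun i _ => hsec i, hfin⟩

theorem tendsto_sectionAt {β : Type*} {A : Set (ℕ × ℕ × ℕ)} {f : ℕ × ℕ × ℕ → β} {l : Filter β}
    (h : Tendsto (A.domRestrict f) cofinite l) (i : ℕ) :
    Tendsto ((sectionAt A i).domRestrict fun s => f (i, s)) cofinite l := by
  refine h.comp (f := fun s : sectionAt A i => (⟨(i, s), s.2⟩ : A)) ?_
  exact Function.Injective.tendsto_cofinite fun s t hst => by simpa [Subtype.ext_iff] using hst

end BI

section Rows

variable {X : Type v} [TopologicalSpace X] {r : ℕ → X} {S : Set (ℕ × ℕ)} {z : X}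

theorem eq_of_infinite_column [T1Space X]
    (hz : Tendsto (S.domRestrict fun s => r s.1) cofinite (𝓝 z)) {x : ℕ}
    (hx : {y | (x, y) ∈ S}.Infinite) : r x = z := by
  refine eq_of_tendsto_of_infinite_fibre hz ?_
  refine (hx.image (Prod.mk_right_injective x).injOn).mono ?_
  rintro _ ⟨y, hy, rfl⟩
  exact ⟨hy, rfl⟩

theorem mem_FinSq_of_tendsto [T1Space X] (hr : r.Injective)
    (hz : Tendsto (S.domRestrict fun s => r s.1) cofinite (𝓝 z)) : S ∈ FinSq :=
  Set.Subsingleton.finite fun _ hx _ hy =>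
    hr ((eq_of_infinite_column hz hx).trans (eq_of_infinite_column hz hy).symm)

theorem eq_of_infinite_of_tendsto [T2Space X] (hS : S.Infinite)
    (hz : Tendsto (S.domRestrict fun s => r s.1) cofinite (𝓝 z)) (hne : ∀ s ∈ S, r s.1 ≠ z)
    {p : X} (hp : Tendsto r atTop (𝓝 p)) : p = z := by
  have : Infinite S := hS.to_subtype
  have hfst : Tendsto (S.domRestrict Prod.fst) cofinite atTop := by
    rw [← Nat.cofinite_eq_atTop]
    refine tendsto_domRestrict_cofinite_cofinite fun x => Set.not_infinite.1 fun hx => ?_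
    obtain ⟨s, hsS, rfl⟩ := hx.nonempty
    refine hne s hsS (eq_of_tendsto_of_infinite_fibre hz (hx.mono ?_))
    exact fun t ht => ⟨ht.1, congrArg r ht.2⟩
  exact tendsto_nhds_unique (hp.comp hfst) hz

end Rows

theorem exists_shift_forall_eventually_ne {α : Type*} {q : ℕ → ℕ → α} (hq : ∀ i, (q i).Injective) :
    ∃ N : ℕ → ℕ, ∀ z, ∃ m, ∀ i ≥ m, ∀ x ≥ N i, q i x ≠ z := by
  have hshift (i : ℕ) : ∃ N, ∀ x ≥ N, ∀ ab ∈ Set.Iic i ×ˢ Set.Iic i, q i x ≠ q ab.1 ab.2 := by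
    refine eventually_atTop.1 ((((Set.finite_Iic i).prod (Set.finite_Iic i)).eventually_all).2 ?_)
    intro ab _
    rw [← Nat.cofinite_eq_atTop]
    exact (hq i).tendsto_cofinite.eventually (eventually_cofinite_ne _)
  choose N hN using hshift
  refine ⟨N, fun z => ?_⟩
  by_cases hz : ∃ a b, q a b = z
  · obtain ⟨a, b, rfl⟩ := hz
    exact ⟨max a b, fun i hi x hx => hN i x hx (a, b) ⟨le_of_max_le_left hi, le_of_max_le_right hi⟩⟩
  · push Not at hz
    exact ⟨0, fun i _ x _ => hz i x⟩

section FinBWBI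

variable {X : Type v} [TopologicalSpace X]

theorem FinBW.exists_injective_tendsto (hX : FinBW BI X) {E : Set X} (hE : E.Infinite) :
    ∃ (p : X) (q : ℕ → X), q.Injective ∧ (∀ n, q n ∈ E) ∧ Tendsto q atTop (𝓝 p) := by
  let g : ℕ × ℕ × ℕ → X := fun t => hE.natEmbedding E (Encodable.encode t)
  have hg : g.Injective := Subtype.val_injective.comp <|
    (hE.natEmbedding E).injective.comp Encodable.encode_injective
  obtain ⟨A, hA, p, hp⟩ := hX g
  have hinf := infinite_of_notMem_BI hA
  exact ⟨p, fun n => g (hinf.natEmbedding A n),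
    hg.comp (Subtype.val_injective.comp (hinf.natEmbedding A).injective),
    fun n => Subtype.coe_prop _, tendsto_natEmbedding hinf hp⟩

theorem FinBW.not_injective_row_limits [T2Space X] (hX : FinBW BI X) {p : ℕ → X}
    {q : ℕ → ℕ → X} (hq : ∀ i, (q i).Injective) (hlim : ∀ i, Tendsto (q i) atTop (𝓝 (p i))) :
    ¬ p.Injective := by
  intro hp
  obtain ⟨N, hN⟩ := exists_shift_forall_eventually_ne hq
  let r : ℕ → ℕ → X := fun i x => q i (x + N i)
  obtain ⟨A, hA, z, hz⟩ := hX fun t => r t.1 t.2.1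
  obtain ⟨m, hm⟩ := hN z
  have hrow (i : ℕ) : sectionAt A i ∈ FinSq :=
    mem_FinSq_of_tendsto (r := r i) ((hq i).comp (add_left_injective (N i)))
      (tendsto_sectionAt hz i)
  have hlimit : ∀ i ≥ m, (sectionAt A i).Infinite → p i = z := fun i hi hinf =>
    eq_of_infinite_of_tendsto (r := r i) hinf (tendsto_sectionAt hz i)
      (fun s _ => hm i hi _ (Nat.le_add_left _ _)) ((hlim i).comp (tendsto_add_atTop_nat (N i)))
  obtain ⟨i, hi, hi_inf⟩ := exists_infinite_sectionAt_of_notMem_BI hA hrow m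
  obtain ⟨j, hj, hj_inf⟩ := exists_infinite_sectionAt_of_notMem_BI hA hrow (i + 1)
  have hij : i = j := hp ((hlimit i hi hi_inf).trans (hlimit j (by lia) hj_inf).symm)
  lia

theorem FinBW.finite_injective_limits [T2Space X] (hX : FinBW BI X) :
    {p : X | ∃ q : ℕ → X, q.Injective ∧ Tendsto q atTop (𝓝 p)}.Finite := by
  by_contra hinf
  let p := Set.Infinite.natEmbedding _ hinf
  choose q hq hlim using fun i => (p i).2
  exact hX.not_injective_row_limits hq hlim (Subtype.val_injective.comp p.injective)

theorem FinBW.exists_finite_forall_finite_compl [T2Space X] (hX : FinBW BI X) :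
    ∃ L : Set X, L.Finite ∧ ∀ U, IsOpen U → L ⊆ U → Uᶜ.Finite := by
  refine ⟨_, hX.finite_injective_limits, fun U hU hLU => ?_⟩
  by_contra hinf
  obtain ⟨p, q, hq, hqU, hlim⟩ := hX.exists_injective_tendsto hinf
  obtain ⟨n, hn⟩ := (hlim.eventually (hU.mem_nhds (hLU ⟨q, hq, hlim⟩))).exists
  exact hqU n hn

theorem FinBW.exists_finite_cofinite_inf_principal_le_nhds [T2Space X] (hX : FinBW BI X) :
    ∃ (L : Set X) (W : X → Set X), L.Finite ∧ (⋃ p ∈ L, W p)ᶜ.Finite ∧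
      ∀ p ∈ L, cofinite ⊓ 𝓟 (W p) ≤ 𝓝 p := by
  obtain ⟨L, hL, hLU⟩ := hX.exists_finite_forall_finite_compl
  obtain ⟨W, hW, hdisj⟩ := hL.t2_separation
  have hcover : (⋃ p ∈ L, W p)ᶜ.Finite := hLU _ (isOpen_biUnion fun p _ => (hW p).2)
    fun p hp => Set.mem_biUnion hp (hW p).1
  refine ⟨L, W, hL, hcover, fun p hp U hU => ?_⟩
  obtain ⟨O, hOU, hO, hpO⟩ := mem_nhds_iff.1 hU
  have hfin : (O ∪ ⋃ r ∈ L \ {p}, W r)ᶜ.Finite := by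
    refine hLU _ (hO.union (isOpen_biUnion fun r _ => (hW r).2)) fun r hr => ?_
    by_cases hrp : r = p
    · exact Or.inl (hrp ▸ hpO)
    · exact Or.inr (Set.mem_biUnion ⟨hr, hrp⟩ (hW r).1)
  rw [mem_inf_principal, mem_cofinite]
  refine hfin.subset fun y hy => ?_
  simp only [Set.mem_compl_iff, Set.mem_ofPred_eq, Classical.not_imp] at hy
  rintro (hyO | hyW)
  · exact hy.2 (hOU hyO)
  · obtain ⟨r, ⟨hr, hrp⟩, hyr⟩ := Set.mem_iUnion₂.1 hyW
    exact Set.disjoint_left.1 (hdisj hr hp hrp) hyr hy.1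

theorem isCountablyGenerated_cofinite_inf_principal {α : Type*} {R : Set α} (hR : R.Countable) :
    (cofinite ⊓ 𝓟 R : Filter α).IsCountablyGenerated := by
  have := hR.to_subtype
  rw [← Subtype.range_coe (s := R), ← map_comap, Subtype.val_injective.comap_cofinite_eq]
  have : (cofinite : Filter R).IsCountablyGenerated :=
    HasCountableBasis.isCountablyGenerated ⟨hasBasis_cofinite, Set.Countable.ofPred_finite⟩
  infer_instance

theorem FinBW.exists_isCountablyGenerated_le_nhds [T2Space X] (hX : FinBW BI X) {R : Set X}
    (hR : R.Countable) {𝒱 : Ultrafilter X} (hRV : R ∈ 𝒱) :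
    ∃ (x : X) (l : Filter X), l.IsCountablyGenerated ∧ ↑𝒱 ≤ l ∧ l ≤ 𝓝 x := by
  rcases 𝒱.le_cofinite_or_eq_pure with hcof | ⟨x, rfl⟩
  · obtain ⟨L, W, hL, hcover, hW⟩ := hX.exists_finite_cofinite_inf_principal_le_nhds
    obtain ⟨p, hp, hpW⟩ : ∃ p ∈ L, W p ∈ 𝒱 := (Ultrafilter.finite_biUnion_mem_iff hL).1 <|
      compl_compl (⋃ p ∈ L, W p) ▸ hcof hcover.compl_mem_cofinite
    refine ⟨p, cofinite ⊓ 𝓟 (R ∩ W p), ?_, le_inf hcof ?_, ?_⟩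
    · exact isCountablyGenerated_cofinite_inf_principal (hR.mono Set.inter_subset_left)
    · exact le_principal_iff.2 (inter_mem hRV hpW)
    · exact (inf_le_inf_left _ (principal_mono.2 Set.inter_subset_right)).trans (hW p hp)
  · exact ⟨x, pure x, isCountablyGenerated_pure x, le_rfl, pure_le_nhds x⟩

end FinBWBI

section Diagonalization

variable {Λ : Type u} {X : Type v} [TopologicalSpace X]

/-- `ρ` diagonalizes `𝒰`: every decreasing sequence of members of `𝒰` has an analogue for `ρ` of a
pseudo-intersection. This is how convergence along `𝒰` yields `ρ`-convergence. -/
def Diagonalizes (𝒰 : Ultrafilter Λ) (ρ : Set ℕ → Set Λ) : Prop :=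
  ∀ U : ℕ → Set Λ, Antitone U → (∀ n, U n ∈ 𝒰) →
    ∃ F : Set ℕ, F.Infinite ∧ ∀ n, ∃ K : Set ℕ, K.Finite ∧ ρ (F \ K) ⊆ U n

theorem Diagonalizes.finBWRho [Countable Λ] [T2Space X] {𝒰 : Ultrafilter Λ} {ρ : Set ℕ → Set Λ}
    (h𝒰 : Diagonalizes 𝒰 ρ) (hX : FinBW BI X) : FinBWRho ρ X := by
  intro f
  obtain ⟨x, l, hl, h𝒰l, hlx⟩ := hX.exists_isCountablyGenerated_le_nhds (Set.countable_range f)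
    (𝒱 := 𝒰.map f) (Ultrafilter.mem_map.2 (univ_mem' Set.mem_range_self))
  obtain ⟨V, hV⟩ := l.exists_antitone_basis
  obtain ⟨F, hF, hFV⟩ := h𝒰 (fun n => f ⁻¹' V n)
    (fun m n hmn => Set.preimage_mono (hV.antitone hmn)) fun n => h𝒰l (hV.mem n)
  refine ⟨F, hF, x, fun U hU => ?_⟩
  obtain ⟨n, -, hn⟩ := hV.1.mem_iff.1 (hlx hU)
  obtain ⟨K, hK, hKV⟩ := hFV n
  exact ⟨K, hK, (Set.image_subset_iff.2 hKV).trans hn⟩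

end Diagonalization

section Ramsey

/-- The pair `{a, b}`, with the junk value `{0, 1}` when `a = b`. -/
def natPair (a b : ℕ) : NatPair :=
  if h : a ≠ b then ⟨{a, b}, Finset.card_pair h⟩ else ⟨{0, 1}, rfl⟩

theorem coe_natPair {a b : ℕ} (h : a ≠ b) : (natPair a b : Finset ℕ) = {a, b} := by
  simp [natPair, h]

theorem exists_lt_eq_natPair {D : Set ℕ} {e : NatPair} (he : e ∈ pairsOf D) :
    ∃ a ∈ D, ∃ b ∈ D, a < b ∧ e = natPair a b := by
  obtain ⟨e, he_card⟩ := e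
  obtain ⟨a, b, hab, rfl⟩ := Finset.card_eq_two.1 he_card
  have ha : a ∈ D := he (by simp)
  have hb : b ∈ D := he (by simp)
  rcases hab.lt_or_gt with hlt | hlt
  · exact ⟨a, ha, b, hb, hlt, Subtype.ext (coe_natPair hab).symm⟩
  · exact ⟨b, hb, a, ha, hlt, Subtype.ext ((Finset.pair_comm a b).trans (coe_natPair hlt.ne).symm)⟩

theorem exists_seq_forall_lt {α : Type*} {W : Filter α} [W.NeBot] {R : ℕ → α → α → Prop}
    (hR : ∀ n, ∀ᶠ a in W, ∀ᶠ b in W, R n a b) : ∃ s : ℕ → α, ∀ i j, i < j → R i (s i) (s j) := by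
  have hpick : ∀ n, ∀ A ∈ W, ∃ a ∈ A, ∀ᶠ b in W, R n a b := fun n A hA =>
    ((eventually_mem_set.2 hA).and (hR n)).exists
  have := W.nonempty_of_neBot
  choose! pick hpick_mem hpick using hpick
  let A : ℕ → Set α := fun n => n.rec Set.univ fun n A => A ∩ {b | R n (pick n A) b}
  have hA (n : ℕ) : A n ∈ W := by
    induction n with
    | zero => exact univ_mem
    | succ n ih => exact inter_mem ih (hpick n _ ih)
  have hA_anti : Antitone A := antitone_nat_of_succ_le fun n => Set.inter_subset_left
  exact ⟨fun n => pick n (A n), fun i j hij => (hA_anti hij (hpick_mem j _ (hA j))).2⟩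

theorem exists_ultrafilter_diagonalizes_pairsOf :
    ∃ 𝒰 : Ultrafilter NatPair, Diagonalizes 𝒰 pairsOf := by
  refine ⟨(hyperfilter ℕ).bind fun a => (hyperfilter ℕ).map (natPair a), fun U hU_anti hU => ?_⟩
  have hlt (a : ℕ) : ∀ᶠ b in hyperfilter ℕ, a < b :=
    Nat.hyperfilter_le_atTop (eventually_gt_atTop a)
  have hR (n : ℕ) : ∀ᶠ a in hyperfilter ℕ, ∀ᶠ b in hyperfilter ℕ, a < b ∧ natPair a b ∈ U n :=
    Eventually.mono (hU n) fun a ha => (hlt a).and ha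
  obtain ⟨s, hs⟩ := exists_seq_forall_lt hR
  have hs_mono : StrictMono s := strictMono_nat_of_lt_succ fun n => (hs n _ n.lt_succ_self).1
  refine ⟨Set.range s, Set.infinite_range_of_injective hs_mono.injective, fun n =>
    ⟨s '' Set.Iio n, (Set.finite_Iio n).image s, ?_⟩⟩
  rw [Set.range_sdiff_image hs_mono.injective, Set.compl_Iio]
  intro e he
  obtain ⟨_, ⟨i, hi, rfl⟩, _, ⟨j, -, rfl⟩, hij, rfl⟩ := exists_lt_eq_natPair he
  exact hU_anti hi (hs i j (hs_mono.lt_iff_lt.1 hij)).2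

theorem FinBW.ramseySpace {X : Type v} [TopologicalSpace X] [T2Space X] (hX : FinBW BI X) :
    RamseySpace X :=
  let ⟨_, h𝒰⟩ := exists_ultrafilter_diagonalizes_pairsOf
  h𝒰.finBWRho hX

end Ramsey

section Hindman

attribute [local instance] Ultrafilter.add Ultrafilter.addSemigroup

theorem exists_idempotent_ultrafilter_le_cofinite (M : Type*) [AddSemigroup M]
    [IsLeftCancelAdd M] [Infinite M] :
    ∃ 𝒰 : Ultrafilter M, ↑𝒰 ≤ (cofinite : Filter M) ∧ 𝒰 + 𝒰 = 𝒰 := by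
  have hclosed : IsClosed {𝒰 : Ultrafilter M | ↑𝒰 ≤ (cofinite : Filter M)} := by
    have : {𝒰 : Ultrafilter M | ↑𝒰 ≤ (cofinite : Filter M)} = ⋂ s ∈ cofinite, {𝒰 | s ∈ 𝒰} := by
      ext 𝒰
      simp [le_def]
    rw [this]
    exact isClosed_biInter fun s _ => ultrafilter_isClosed_basic s
  obtain ⟨𝒰, h𝒰, hidem⟩ := exists_idempotent_in_compact_add_subsemigroup
    Ultrafilter.continuous_add_left _ ⟨hyperfilter M, hyperfilter_le_cofinite⟩ hclosed.isCompact
    fun 𝒱 _ 𝒲 h𝒲 s hs => Ultrafilter.eventually_add 𝒱 𝒲 (· ∈ s) |>.2 <|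
      Eventually.of_forall fun a => h𝒲 ((add_right_injective a).tendsto_cofinite hs)
  exact ⟨𝒰, h𝒰, hidem⟩

theorem sum_mem_of_forall_add_mem {M : Type*} [AddCommMonoid M] {A : ℕ → Set M} {d : ℕ → M}
    (hA : Antitone A) (hd : ∀ n, d n ∈ A n) (hadd : ∀ n, ∀ m ∈ A (n + 1), d n + m ∈ A n)
    {t : Finset ℕ} (ht : t.Nonempty) {n : ℕ} (hn : ∀ i ∈ t, n ≤ i) : ∑ i ∈ t, d i ∈ A n := by
  induction t using Finset.induction_on_min generalizing n with
  | empty => simp at ht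
  | insert a t hat ih =>
    refine hA (hn a (Finset.mem_insert_self a t)) ?_
    rw [Finset.sum_insert fun h => (hat a h).false]
    rcases t.eq_empty_or_nonempty with rfl | ht'
    · simpa using hd a
    · exact hadd a _ (ih ht' fun i hi => hat i hi)

theorem exists_seq_sum_mem {𝒰 : Ultrafilter ℕ} (hcof : ↑𝒰 ≤ (cofinite : Filter ℕ))
    (hidem : 𝒰 + 𝒰 = 𝒰) {U : ℕ → Set ℕ} (hU : ∀ n, U n ∈ 𝒰) :
    ∃ d : ℕ → ℕ, StrictMono d ∧ ∀ n, ∀ t : Finset ℕ, t.Nonempty → (∀ i ∈ t, n ≤ i) →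
      ∑ i ∈ t, d i ∈ U n := by
  have hgt (k : ℕ) : ∀ᶠ m in 𝒰, k < m := by
    rw [Nat.cofinite_eq_atTop] at hcof
    exact hcof (eventually_gt_atTop k)
  have hpick : ∀ A ∈ 𝒰, ∃ a ∈ A, ∀ᶠ m in 𝒰, a + m ∈ A := fun A hA =>
    ((eventually_mem_set.2 hA).and
      ((Ultrafilter.eventually_add 𝒰 𝒰 (· ∈ A)).1 (hidem.symm ▸ hA))).exists
  choose! pick hpick_mem hpick_add using hpick
  let A : ℕ → Set ℕ := fun n =>
    n.rec (U 0) fun n A => A ∩ (U (n + 1) ∩ {m | pick A < m ∧ pick A + m ∈ A})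
  have hA (n : ℕ) : A n ∈ 𝒰 := by
    induction n with
    | zero => exact hU 0
    | succ n ih => exact inter_mem ih (inter_mem (hU _) ((hgt _).and (hpick_add _ ih)))
  have hAU (n : ℕ) : A n ⊆ U n := by
    cases n with
    | zero => exact subset_rfl
    | succ n => exact fun m hm => hm.2.1
  have hA_anti : Antitone A := antitone_nat_of_succ_le fun n => Set.inter_subset_left
  refine ⟨fun n => pick (A n), strictMono_nat_of_lt_succ fun n =>
    (hpick_mem _ (hA (n + 1))).2.2.1, fun n t ht hn => hAU n ?_⟩
  exact sum_mem_of_forall_add_mem hA_anti (fun n => hpick_mem _ (hA n))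
    (fun n m hm => hm.2.2.2) ht hn

theorem exists_ultrafilter_diagonalizes_finiteSums :
    ∃ 𝒰 : Ultrafilter ℕ, Diagonalizes 𝒰 finiteSums := by
  obtain ⟨𝒰, hcof, hidem⟩ := exists_idempotent_ultrafilter_le_cofinite ℕ
  refine ⟨𝒰, fun U _ hU => ?_⟩
  obtain ⟨d, hd, hsum⟩ := exists_seq_sum_mem hcof hidem hU
  refine ⟨Set.range d, Set.infinite_range_of_injective hd.injective, fun n =>
    ⟨d '' Set.Iio n, (Set.finite_Iio n).image d, ?_⟩⟩
  rw [Set.range_sdiff_image hd.injective, Set.compl_Iio]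
  rintro _ ⟨s, hs, hsD, rfl⟩
  obtain ⟨t, htn, rfl⟩ := Finset.subset_set_image_iff.1 hsD
  rw [Finset.sum_image hd.injective.injOn]
  exact hsum n t (Finset.image_nonempty.1 hs) fun i hi => htn hi

theorem FinBW.hindmanSpace {X : Type v} [TopologicalSpace X] [T2Space X] (hX : FinBW BI X) :
    HindmanSpace X :=
  let ⟨_, h𝒰⟩ := exists_ultrafilter_diagonalizes_finiteSums
  h𝒰.finBWRho hX

end Hindman

section Ideals

variable {Λ : Type u} {I : Set (Set Λ)}

theorem IsIdealOn.infinite_of_notMem (hI : IsIdealOn I) {B : Set Λ} (hB : B ∉ I) : B.Infinite :=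
  fun h => hB (hI.finite_mem B h)

theorem IsIdealOn.biUnion_mem (hI : IsIdealOn I) {ι : Type*} {s : Set ι} (hs : s.Finite)
    {g : ι → Set Λ} (hg : ∀ i ∈ s, g i ∈ I) : (⋃ i ∈ s, g i) ∈ I := by
  induction s, hs using Set.Finite.induction_on with
  | empty => simpa using hI.finite_mem ∅ Set.finite_empty
  | insert _ _ ih =>
    rw [Set.biUnion_insert]
    exact hI.union_mem _ _ (hg _ (Set.mem_insert _ _))
      (ih fun i hi => hg i (Set.mem_insert_of_mem _ hi))

theorem IsIdealOn.sdiff_biUnion_notMem (hI : IsIdealOn I) {ι : Type*} {s : Set ι} (hs : s.Finite)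
    {B : Set Λ} (hB : B ∉ I) {g : ι → Set Λ} (hg : ∀ i ∈ s, B ∩ g i ∈ I) :
    B \ ⋃ i ∈ s, g i ∉ I := by
  intro h
  refine hB ?_
  rw [← Set.inter_union_sdiff B (⋃ i ∈ s, g i), Set.inter_iUnion₂]
  exact hI.union_mem _ _ (hI.biUnion_mem hs hg) h

/-- The Katětov order `J ≤_K I ↾ L` below the restriction of `I` to `L`, with the reduction defined
on all of `Λ`. -/
def KatetovLEOn {Γ : Type v} (J : Set (Set Γ)) (I : Set (Set Λ)) (L : Set Λ) : Prop :=
  ∃ φ : Λ → Γ, ∀ B ⊆ L, B ∉ I → φ '' B ∉ J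

theorem KatetovLEOn.katetovLE {Γ : Type v} {J : Set (Set Γ)} (hI : IsIdealOn I)
    (hJ : ∀ ⦃A B : Set Γ⦄, B ∈ J → A ⊆ B → A ∈ J) {L : Set Λ} (hL : KatetovLEOn J I L)
    (hLc : KatetovLEOn J I Lᶜ) : KatetovLE J I := by
  classical
  obtain ⟨φ, hφ⟩ := hL
  obtain ⟨ψ, hψ⟩ := hLc
  refine ⟨fun l => if l ∈ L then φ l else ψ l, fun B hB hmem => hB ?_⟩
  rw [← Set.inter_union_compl B L]
  refine hI.union_mem _ _ ?_ ?_
  · by_contra hpos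
    refine hφ _ Set.inter_subset_right hpos (hJ hmem ?_)
    rintro _ ⟨l, hl, rfl⟩
    exact ⟨l, hl.1, if_pos hl.2⟩
  · by_contra hpos
    refine hψ _ Set.inter_subset_right hpos (hJ hmem ?_)
    rintro _ ⟨l, hl, rfl⟩
    exact ⟨l, hl.1, if_neg hl.2⟩

end Ideals

section FiniteToOne

variable {Λ : Type u} {I : Set (Set Λ)} {B : Set Λ} {f ι : Λ → ℕ} {r : ℕ → ℕ}

theorem exists_finite_rank_fibres_of_image_mem_BI (hι : ι.Injective)
    (hB : (fun l => (r (f l), f l, ι l)) '' B ∈ BI) :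
    ∃ k, ∀ i ≥ k, {l ∈ B | r (f l) = i}.Finite := by
  obtain ⟨k, -, hge⟩ := hB
  have hinj : (fun l => (f l, ι l)).Injective := fun a b h => hι (congrArg Prod.snd h)
  refine ⟨k, fun i hi => ((hge i hi).preimage hinj.injOn).subset ?_⟩
  rintro l ⟨hl, rfl⟩
  exact ⟨l, hl, rfl⟩

theorem finite_infinite_fibres_of_image_mem_BI (hι : ι.Injective)
    (hB : (fun l => (r (f l), f l, ι l)) '' B ∈ BI) :
    {n | (B ∩ f ⁻¹' {n}).Infinite}.Finite := by
  obtain ⟨k, hk⟩ := exists_finite_rank_fibres_of_image_mem_BI hι hB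
  obtain ⟨k', hlt, hge⟩ := hB
  have hFinSq (i : ℕ) : sectionAt ((fun l => (r (f l), f l, ι l)) '' B) i ∈ FinSq := by
    by_cases hi : i < k'
    · exact hlt i hi
    · refine Set.finite_empty.subset fun n hn => hn ?_
      exact (hge i (not_lt.1 hi)).preimage (Prod.mk_right_injective n).injOn
  refine ((Set.finite_Iio k).biUnion fun i _ => hFinSq i).subset fun n hn => ?_
  refine Set.mem_biUnion (x := r n) (lt_of_not_ge fun hkn => hn ((hk _ hkn).subset ?_)) ?_
  · rintro l ⟨hl, rfl⟩
    exact ⟨hl, rfl⟩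
  · refine (hn.image hι.injOn).mono ?_
    rintro _ ⟨l, ⟨hl, rfl⟩, rfl⟩
    exact ⟨l, hl, rfl⟩

theorem IsIdealOn.exists_subset_tendsto_cofinite (hI : IsIdealOn I) (hB : B ∉ I)
    (hf : ∀ n, B ∩ f ⁻¹' {n} ∈ I) (hfin : {n | (B ∩ f ⁻¹' {n}).Infinite}.Finite) :
    ∃ C ⊆ B, C ∉ I ∧ Tendsto (C.domRestrict f) cofinite cofinite := by
  refine ⟨_, Set.sdiff_subset, hI.sdiff_biUnion_notMem hfin hB fun n _ => hf n,
    tendsto_domRestrict_cofinite_cofinite fun n => ?_⟩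
  by_cases hn : (B ∩ f ⁻¹' {n}).Infinite
  · refine Set.finite_empty.subset ?_
    rintro l ⟨⟨-, hl⟩, rfl⟩
    exact hl (Set.mem_biUnion hn rfl)
  · exact (Set.not_infinite.1 hn).subset (Set.inter_subset_inter_left _ Set.sdiff_subset)

theorem IsIdealOn.exists_tendsto_cofinite_of_not_katetovLEOn [Countable Λ] (hI : IsIdealOn I)
    {L : Set Λ} (hL : ¬ KatetovLEOn BI I L) (hf : ∀ n, L ∩ f ⁻¹' {n} ∈ I) (r : ℕ → ℕ) :
    ∃ B ⊆ L, B ∉ I ∧ Tendsto (B.domRestrict f) cofinite cofinite ∧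
      ∃ k, ∀ i ≥ k, {l ∈ B | r (f l) = i}.Finite := by
  obtain ⟨ι, hι⟩ := exists_injective_nat Λ
  unfold KatetovLEOn at hL
  push Not at hL
  obtain ⟨B, hBL, hB, hBI⟩ := hL fun l => (r (f l), f l, ι l)
  have hfB (n : ℕ) : B ∩ f ⁻¹' {n} ∈ I :=
    hI.subset_mem _ _ (hf n) (Set.inter_subset_inter_left _ hBL)
  obtain ⟨C, hCB, hC, hCf⟩ :=
    hI.exists_subset_tendsto_cofinite hB hfB (finite_infinite_fibres_of_image_mem_BI hι hBI)
  obtain ⟨k, hk⟩ := exists_finite_rank_fibres_of_image_mem_BI hι hBI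
  exact ⟨C, hCB.trans hBL, hC, hCf, k, fun i hi => (hk i hi).subset fun l hl => ⟨hCB hl.1, hl.2⟩⟩

theorem IsIdealOn.exists_subset_image_subset_or_almostDisjoint (hI : IsIdealOn I) (hB : B ∉ I)
    {A : ℕ → Set ℕ} (hrA : ∀ m, m ∈ A (r m)) (hAr : ∀ n, ∀ m ∈ A n, r m ≤ n)
    (hfin : ∃ k, ∀ i ≥ k, {l ∈ B | r (f l) = i}.Finite) :
    ∃ C ⊆ B, C ∉ I ∧ ((∃ n, f '' C ⊆ A n) ∨ ∀ n, (f '' C ∩ A n).Finite) := by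
  obtain ⟨k, hk⟩ := hfin
  by_cases hpos : ∃ i < k, B ∩ f ⁻¹' A i ∉ I
  · obtain ⟨i, -, hi⟩ := hpos
    refine ⟨_, Set.inter_subset_left, hi, Or.inl ⟨i, ?_⟩⟩
    rintro _ ⟨l, hl, rfl⟩
    exact hl.2
  push Not at hpos
  refine ⟨_, Set.sdiff_subset, hI.sdiff_biUnion_notMem (Set.finite_Iio k) hB hpos,
    Or.inr fun n => ?_⟩
  refine (((Set.finite_Icc k n).biUnion fun i hi => hk i hi.1).image f).subset ?_
  rintro _ ⟨⟨l, ⟨hlB, hl⟩, rfl⟩, hn⟩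
  refine ⟨l, Set.mem_biUnion (x := r (f l)) ⟨?_, hAr n _ hn⟩ ⟨hlB, rfl⟩, rfl⟩
  exact le_of_not_gt fun hlt => hl (Set.mem_biUnion hlt (hrA (f l)))

end FiniteToOne

section AlmostDisjoint

variable {Λ : Type u} {𝒜 : Set (Set Λ)}

theorem IsAlmostDisjointFamily.insert (h𝒜 : IsAlmostDisjointFamily 𝒜) {C : Set Λ}
    (hC : C.Infinite) (hCA : ∀ A ∈ 𝒜, (C ∩ A).Finite) : IsAlmostDisjointFamily (insert C 𝒜) := by
  refine ⟨Set.forall_mem_insert.2 ⟨hC, h𝒜.1⟩, ?_⟩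
  rintro A (rfl | hA) B (rfl | hB) hne
  · exact absurd rfl hne
  · exact hCA B hB
  · exact Set.inter_comm B A ▸ hCA A hA
  · exact h𝒜.2 A hA B hB hne

theorem IsAlmostDisjointFamily.sUnion {c : Set (Set (Set Λ))} (hc : IsChain (· ⊆ ·) c)
    (h : ∀ ℬ ∈ c, IsAlmostDisjointFamily ℬ) : IsAlmostDisjointFamily (⋃₀ c) := by
  refine ⟨fun A ⟨ℬ, hℬ, hA⟩ => (h ℬ hℬ).1 A hA, ?_⟩
  rintro A ⟨ℬ, hℬ, hA⟩ B ⟨𝒞, h𝒞, hB⟩ hne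
  rcases hc.total hℬ h𝒞 with hsub | hsub
  · exact (h 𝒞 h𝒞).2 A (hsub hA) B hB hne
  · exact (h ℬ hℬ).2 A hA B (hsub hB) hne

theorem IsAlmostDisjointFamily.exists_isMADFamily (h𝒜 : IsAlmostDisjointFamily 𝒜) :
    ∃ ℬ, 𝒜 ⊆ ℬ ∧ IsMADFamily ℬ :=
  zorn_subset_nonempty {ℬ | IsAlmostDisjointFamily ℬ}
    (fun c hc hchain _ => ⟨⋃₀ c, .sUnion hchain hc, fun _ => Set.subset_sUnion_of_mem⟩) 𝒜 h𝒜

theorem IsMADFamily.exists_infinite_inter (h𝒜 : IsMADFamily 𝒜) {E : Set Λ} (hE : E.Infinite) :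
    ∃ A ∈ 𝒜, (E ∩ A).Infinite := by
  by_contra! h
  have hE𝒜 : E ∈ 𝒜 := h𝒜.2 (h𝒜.1.insert hE h) (Set.subset_insert E 𝒜) (Set.mem_insert E 𝒜)
  exact hE (Set.inter_self E ▸ h E hE𝒜)

theorem IsMADFamily.exists_strictMono_forall_mem (h𝒜 : IsMADFamily 𝒜) {v : ℕ → Λ}
    (hv : Tendsto v atTop cofinite) :
    ∃ A ∈ 𝒜, ∃ φ : ℕ → ℕ, StrictMono φ ∧ ∀ n, v (φ n) ∈ A := by
  have hrange : (Set.range v).Infinite := fun hfin =>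
    have ⟨n, hn⟩ := (hv.eventually hfin.compl_mem_cofinite).exists
    hn ⟨n, rfl⟩
  obtain ⟨A, hA, hvA⟩ := h𝒜.exists_infinite_inter hrange
  refine ⟨A, hA, extraction_of_frequently_atTop (P := (v · ∈ A)) ?_⟩
  rw [← Nat.cofinite_eq_atTop, frequently_cofinite_iff_infinite]
  refine Set.Infinite.of_image v (hvA.mono ?_)
  rintro _ ⟨⟨n, rfl⟩, hn⟩
  exact ⟨n, hn, rfl⟩

theorem IsMADFamily.not_countable (h𝒜 : IsMADFamily 𝒜) (hinf : 𝒜.Infinite) : ¬ 𝒜.Countable := by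
  intro hc
  have := hc.to_subtype
  have := hinf.to_subtype
  obtain ⟨e⟩ := nonempty_equiv_of_countable (α := ℕ) (β := 𝒜)
  have hdiag (n : ℕ) : ((e n : Set Λ) \ ⋃ i ∈ Set.Iio n, (e n : Set Λ) ∩ e i).Infinite :=
    (h𝒜.1.1 _ (e n).2).sdiff ((Set.finite_Iio n).biUnion fun i hi =>
      h𝒜.1.2 _ (e n).2 _ (e i).2 fun h => hi.ne' (e.injective (Subtype.ext h)))
  choose c hc using fun n => (hdiag n).nonempty
  have hlt {i n : ℕ} (hin : i < n) : c n ∉ (e i : Set Λ) := fun h =>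
    (hc n).2 (Set.mem_biUnion hin ⟨(hc n).1, h⟩)
  have hinj : c.Injective := .of_lt_imp_ne fun i n hin h =>
    hlt hin (h ▸ (hc i).1)
  obtain ⟨A, hA, hcA⟩ := h𝒜.exists_infinite_inter (Set.infinite_range_of_injective hinj)
  obtain ⟨i, hi⟩ := e.surjective ⟨A, hA⟩
  refine hcA (((Set.finite_Iic i).image c).subset ?_)
  rintro _ ⟨⟨n, rfl⟩, hn⟩
  refine ⟨n, not_lt.1 fun hin => hlt hin ?_, rfl⟩
  rwa [hi]

end AlmostDisjoint

theorem exists_wellOrder_forall_countable_Iio {T : Type*}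
    (hT : Cardinal.mk T ≤ Cardinal.aleph 1) :
    ∃ (_ : LinearOrder T) (_ : WellFoundedLT T), ∀ t : T, (Set.Iio t).Countable := by
  obtain ⟨_, _, hord⟩ := Cardinal.exists_ord_eq_type_lt T
  refine ⟨_, ‹_›, fun t => ?_⟩
  rw [← Cardinal.le_aleph0_iff_set_countable, ← Order.lt_succ_iff, Cardinal.succ_aleph0]
  exact (Cardinal.mk_Iio_lt t hord).trans_le hT

section ExtensionStage

variable {T α : Type*} [LinearOrder T] [WellFoundedLT T] {G : T → Set α → Set α} {E : Set α}

/-- The stages of a transfinite construction indexed by `T`: starting from `E`, stage `t` applies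
the extension operator `G t` to the union of `E` and all earlier stages. -/
noncomputable def extensionStage (G : T → Set α → Set α) (E : Set α) : T → Set α :=
  wellFounded_lt.fix fun t S => G t (E ∪ ⋃ s : Set.Iio t, S s s.2)

theorem extensionStage_eq (t : T) :
    extensionStage G E t = G t (⋃₀ insert E (extensionStage G E '' Set.Iio t)) := by
  rw [extensionStage, WellFounded.fix_eq, Set.sUnion_insert, Set.sUnion_image,
    Set.biUnion_eq_iUnion]

theorem sUnion_subset_extensionStage (hG : ∀ t s, s ⊆ G t s) (t : T) :
    ⋃₀ insert E (extensionStage G E '' Set.Iio t) ⊆ extensionStage G E t := by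
  rw [extensionStage_eq t]
  exact hG t _

theorem isChain_insert_image_extensionStage (hG : ∀ t s, s ⊆ G t s) (A : Set T) :
    IsChain (· ⊆ ·) (insert E (extensionStage G E '' A)) := by
  have hmono : Monotone (extensionStage G E) := monotone_iff_forall_lt.2 fun s t hst =>
    (Set.subset_sUnion_of_mem (.inr ⟨s, hst, rfl⟩)).trans (sUnion_subset_extensionStage hG t)
  refine (hmono.isChain_image (isChain_of_trichotomous A)).insert ?_
  rintro _ ⟨t, -, rfl⟩ -
  exact .inl ((Set.subset_sUnion_of_mem (.inl rfl)).trans (sUnion_subset_extensionStage hG t))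

end ExtensionStage

theorem exists_forall_of_countable_extensions {T α : Type*}
    (hT : Cardinal.mk T ≤ Cardinal.aleph 1) {P : Set α → Prop} {Q : T → Set α → Prop}
    (hP : ∀ c, IsChain (· ⊆ ·) c → (∀ s ∈ c, P s) → P (⋃₀ c)) (hQ : ∀ t, Monotone (Q t))
    {E : Set α} (hEc : E.Countable) (hE : P E)
    (hext : ∀ t s, E ⊆ s → s.Countable → P s → ∃ s', s ⊆ s' ∧ s'.Countable ∧ P s' ∧ Q t s') :
    ∃ s, E ⊆ s ∧ P s ∧ ∀ t, Q t s := by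
  obtain ⟨_, _, hIio⟩ := exists_wellOrder_forall_countable_Iio hT
  have hext' (t : T) (s : Set α) :
      ∃ s', s ⊆ s' ∧ (E ⊆ s ∧ s.Countable ∧ P s → s'.Countable ∧ P s' ∧ Q t s') := by
    by_cases h : E ⊆ s ∧ s.Countable ∧ P s
    · obtain ⟨s', hs, hs'⟩ := hext t s h.1 h.2.1 h.2.2
      exact ⟨s', hs, fun _ => hs'⟩
    · exact ⟨s, subset_rfl, fun h' => absurd h' h⟩
  choose G hG hGext using hext'
  have hstage (t : T) : (extensionStage G E t).Countable ∧ P (extensionStage G E t) ∧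
      Q t (extensionStage G E t) := by
    induction t using WellFoundedLT.induction with
    | _ t ih =>
      rw [extensionStage_eq t]
      refine hGext t _ ⟨Set.subset_sUnion_of_mem (.inl rfl), ?_, ?_⟩
      · refine (((hIio t).image _).insert E).sUnion (Set.forall_mem_insert.2 ⟨hEc, ?_⟩)
        exact Set.forall_mem_image.2 fun s hs => (ih s hs).1
      · refine hP _ (isChain_insert_image_extensionStage hG _) (Set.forall_mem_insert.2 ⟨hE, ?_⟩)
        exact Set.forall_mem_image.2 fun s hs => (ih s hs).2.1
  refine ⟨⋃₀ insert E (extensionStage G E '' Set.univ), Set.subset_sUnion_of_mem (.inl rfl),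
    hP _ (isChain_insert_image_extensionStage hG _) (Set.forall_mem_insert.2 ⟨hE, ?_⟩),
    fun t => hQ t (Set.subset_sUnion_of_mem (.inr ⟨t, trivial, rfl⟩)) (hstage t).2.2⟩
  exact Set.forall_mem_image.2 fun t _ => (hstage t).2.1

namespace MrowkaSpace

variable {Λ : Type u} {𝒜 : Set (Set Λ)}

/-- The clopen neighbourhood `{A} ∪ (A \ F)` of `A ∈ 𝒜` in `Ψ(𝒜)`, basic when `F` is finite. -/
def basicSet (A : 𝒜) (F : Set Λ) : Set (MrowkaSpace 𝒜) :=
  insert (member A) (point '' ((A : Set Λ) \ F))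

theorem isOpen_basicSet (A : 𝒜) {F : Set Λ} (hF : F.Finite) : IsOpen (basicSet A F) := by
  rintro B (hB | ⟨n, -, hn⟩)
  · obtain rfl : B = A := by simpa using hB
    exact ⟨F, hF, fun n hn => .inr ⟨n, hn, rfl⟩⟩
  · cases hn

theorem isOpen_singleton_point (n : Λ) : IsOpen {(point n : MrowkaSpace 𝒜)} := by
  rintro A ⟨⟩

theorem disjoint_basicSet {A B : 𝒜} (hAB : A ≠ B) :
    Disjoint (basicSet A (A ∩ B)) (basicSet B ∅) := by
  refine Set.disjoint_left.2 ?_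
  rintro _ (rfl | ⟨n, hn, rfl⟩) (h | ⟨m, hm, h⟩)
  · exact hAB (member.inj h)
  · cases h
  · cases h
  · cases h
    exact hn.2 ⟨hn.1, hm.1⟩

theorem t2Space (h𝒜 : IsAlmostDisjointFamily 𝒜) : T2Space (MrowkaSpace 𝒜) := by
  have hsep (n : Λ) (A : 𝒜) : ∃ U V : Set (MrowkaSpace 𝒜), IsOpen U ∧ IsOpen V ∧
      point n ∈ U ∧ member A ∈ V ∧ Disjoint U V :=
    ⟨_, _, isOpen_singleton_point n, isOpen_basicSet A (Set.finite_singleton n), rfl, .inl rfl,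
      by simp [basicSet]⟩
  refine ⟨fun x y hxy => ?_⟩
  rcases x with n | A <;> rcases y with m | B
  · exact ⟨_, _, isOpen_singleton_point n, isOpen_singleton_point m, rfl, rfl, by simpa using hxy⟩
  · exact hsep n B
  · obtain ⟨U, V, hU, hV, hmU, hAV, hUV⟩ := hsep m A
    exact ⟨V, U, hV, hU, hAV, hmU, hUV.symm⟩
  · have hAB : A ≠ B := fun h => hxy (congrArg _ h)
    exact ⟨_, _, isOpen_basicSet A (h𝒜.2 A A.2 B B.2 (Subtype.coe_ne_coe.2 hAB)),
      isOpen_basicSet B Set.finite_empty, .inl rfl, .inl rfl, disjoint_basicSet hAB⟩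

theorem tendsto_member {ι : Type*} {l : Filter ι} {A : 𝒜} {g : ι → Λ}
    (hgA : ∀ᶠ i in l, g i ∈ (A : Set Λ)) (hg : Tendsto g l cofinite) :
    Tendsto (fun i => (point (g i) : MrowkaSpace 𝒜)) l (𝓝 (member A)) := by
  refine tendsto_nhds.2 fun U hU hAU => ?_
  obtain ⟨F, hF, hFU⟩ := hU A hAU
  filter_upwards [hgA, hg hF.compl_mem_cofinite] with i hi hiF
  exact hFU _ ⟨hi, hiF⟩

theorem isCompact_basicSet (A : 𝒜) : IsCompact (basicSet A ∅) := by
  have htendsto : Tendsto (fun n : (A : Set Λ) => (point n.1 : MrowkaSpace 𝒜)) cofinite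
      (𝓝 (member A)) :=
    tendsto_member (.of_forall Subtype.property) Subtype.val_injective.tendsto_cofinite
  convert htendsto.isCompact_insert_range_of_cofinite
  ext x
  simp [basicSet]

theorem weaklyLocallyCompactSpace : WeaklyLocallyCompactSpace (MrowkaSpace 𝒜) := by
  refine ⟨fun x => ?_⟩
  rcases x with n | A
  · exact ⟨_, isCompact_singleton, (isOpen_singleton_point n).mem_nhds rfl⟩
  · exact ⟨_, isCompact_basicSet A, (isOpen_basicSet A Set.finite_empty).mem_nhds (.inl rfl)⟩

theorem isClosed_of_forall_point_notMem {D : Set (MrowkaSpace 𝒜)} (hD : ∀ n, point n ∉ D) :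
    IsClosed D :=
  ⟨fun _ _ => ⟨∅, Set.finite_empty, fun n _ => hD n⟩⟩

theorem finite_sdiff_range_point_of_isCompact {K : Set (MrowkaSpace 𝒜)} (hK : IsCompact K) :
    (K \ Set.range point).Finite := by
  have hclosed (D : Set (MrowkaSpace 𝒜)) (hD : D ⊆ K \ Set.range point) : IsClosed D :=
    isClosed_of_forall_point_notMem fun n hn => (hD hn).2 ⟨n, rfl⟩
  refine (hK.of_isClosed_subset (hclosed _ subset_rfl) Set.sdiff_subset).finite ?_
  exact isDiscrete_iff_forall_mem_exists_isClosed.2 fun D hD =>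
    ⟨D, hclosed D hD, Set.inter_eq_left.2 hD⟩

/-- The underlying set of `Ψ(𝒜)` as a disjoint union. -/
def equivSum : MrowkaSpace 𝒜 ≃ Λ ⊕ 𝒜 where
  toFun
    | point n => .inl n
    | member A => .inr A
  invFun := Sum.elim point member
  left_inv := by rintro (_ | _) <;> rfl
  right_inv := by rintro (_ | _) <;> rfl

end MrowkaSpace

namespace FranklinSpace

variable {Λ : Type u} {𝒜 : Set (Set Λ)}

/-- The isolated point `n` of `Φ(𝒜)`. -/
abbrev point (n : Λ) : FranklinSpace 𝒜 := (MrowkaSpace.point n : MrowkaSpace 𝒜)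

/-- The point `A ∈ 𝒜` of `Φ(𝒜)`. -/
abbrev member (A : 𝒜) : FranklinSpace 𝒜 := (MrowkaSpace.member A : MrowkaSpace 𝒜)

theorem t2Space (h𝒜 : IsAlmostDisjointFamily 𝒜) : T2Space (FranklinSpace 𝒜) := by
  have := MrowkaSpace.t2Space h𝒜
  have := MrowkaSpace.weaklyLocallyCompactSpace (𝒜 := 𝒜)
  infer_instance

theorem tendsto_member {ι : Type*} {l : Filter ι} {A : 𝒜} {g : ι → Λ}
    (hgA : ∀ᶠ i in l, g i ∈ (A : Set Λ)) (hg : Tendsto g l cofinite) :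
    Tendsto (fun i => (point (g i) : FranklinSpace 𝒜)) l (𝓝 (member A)) :=
  (OnePoint.continuous_coe.tendsto _).comp (MrowkaSpace.tendsto_member hgA hg)

theorem tendsto_infty {ι : Type*} {l : Filter ι} {g : ι → FranklinSpace 𝒜}
    (hpoint : ∀ᶠ i in l, g i ∉ Set.range point) (hg : Tendsto g l cofinite) :
    Tendsto g l (𝓝 OnePoint.infty) := by
  refine OnePoint.hasBasis_nhds_infty.tendsto_right_iff.2 fun K ⟨_, hK⟩ => ?_
  have hfin := (MrowkaSpace.finite_sdiff_range_point_of_isCompact hK).image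
    ((↑) : MrowkaSpace 𝒜 → FranklinSpace 𝒜)
  filter_upwards [hpoint, hg.eventually hfin.eventually_cofinite_notMem] with i hi hiK
  generalize g i = x at hi hiK ⊢
  induction x using OnePoint.rec with
  | infty => exact .inr rfl
  | coe x =>
    refine .inl ⟨x, fun hxK => hiK ⟨x, ⟨hxK, ?_⟩, rfl⟩, rfl⟩
    rintro ⟨n, rfl⟩
    exact hi ⟨n, rfl⟩

theorem separableSpace [Countable Λ] (h𝒜 : ∀ A ∈ 𝒜, A.Infinite) :
    TopologicalSpace.SeparableSpace (FranklinSpace 𝒜) := by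
  refine ⟨insert OnePoint.infty (Set.range point), (Set.countable_range _).insert _, fun x => ?_⟩
  induction x using OnePoint.rec with
  | infty => exact subset_closure (.inl rfl)
  | coe x =>
    rcases x with n | A
    · exact subset_closure (.inr ⟨n, rfl⟩)
    · have := (h𝒜 A A.2).to_subtype
      exact mem_closure_of_tendsto (tendsto_member (.of_forall Subtype.property)
        Subtype.val_injective.tendsto_cofinite) (.of_forall fun n : (A : Set Λ) => .inr ⟨n, rfl⟩)

theorem exists_finite_subset_of_rhoConverges_member {ρ : Set ℕ → Set Λ} {F : Set ℕ} {A : 𝒜}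
    (h : RhoConverges ρ F (point : Λ → FranklinSpace 𝒜) (member A)) :
    ∃ K : Set ℕ, K.Finite ∧ ρ (F \ K) ⊆ A := by
  obtain ⟨K, hK, hKA⟩ := h _ ((OnePoint.isOpenMap_coe _
    (MrowkaSpace.isOpen_basicSet A Set.finite_empty)).mem_nhds ⟨_, .inl rfl, rfl⟩)
  refine ⟨K, hK, fun n hn => ?_⟩
  obtain ⟨y, hy, hyn⟩ := hKA ⟨n, hn, rfl⟩
  obtain rfl := OnePoint.coe_injective hyn
  rcases hy with hy | ⟨m, hm, hy⟩
  · cases hy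
  · cases hy
    exact hm.1

theorem mk_eq [Countable Λ] (h𝒜 : 𝒜.Infinite) :
    Cardinal.mk (FranklinSpace 𝒜) = Cardinal.mk 𝒜 := by
  have := h𝒜.to_subtype
  have h𝒜₀ := Cardinal.aleph0_le_mk 𝒜
  calc Cardinal.mk (Option (MrowkaSpace 𝒜))
    _ = Cardinal.mk Λ + Cardinal.mk 𝒜 + 1 := by
      simp [Cardinal.mk_option, MrowkaSpace.equivSum.cardinal_eq]
    _ = Cardinal.mk 𝒜 := by
      rw [Cardinal.add_eq_right h𝒜₀ (Cardinal.mk_le_aleph0.trans h𝒜₀), Cardinal.add_one_eq h𝒜₀]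

end FranklinSpace

theorem IsMADFamily.mk_eq_continuum (hCH : Cardinal.continuum.{0} = Cardinal.aleph.{0} 1)
    {𝒜 : Set (Set ℕ)} (h𝒜 : IsMADFamily 𝒜) (hinf : 𝒜.Infinite) :
    Cardinal.mk 𝒜 = Cardinal.continuum := by
  refine le_antisymm ?_ ?_
  · simpa using Cardinal.mk_set_le 𝒜
  · rw [hCH, ← Cardinal.succ_aleph0, Order.succ_le_iff, ← not_le,
      Cardinal.le_aleph0_iff_set_countable]
    exact h𝒜.not_countable hinf

section Valuation

theorem padicValNat_two_pow_mul_odd {c : ℕ} (hc : Odd c) (a : ℕ) :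
    padicValNat 2 (2 ^ a * c) = a := by
  rw [padicValNat.mul (by positivity) hc.pos.ne', padicValNat.prime_pow,
    padicValNat.eq_zero_of_not_dvd hc.not_two_dvd_nat, add_zero]

theorem padicValNat_two_lt_add_of_eq {m n : ℕ} (hm : m ≠ 0) (hn : n ≠ 0)
    (h : padicValNat 2 m = padicValNat 2 n) : padicValNat 2 m < padicValNat 2 (m + n) := by
  obtain ⟨a, c, hc, rfl⟩ := Nat.exists_eq_two_pow_mul_odd hm
  obtain ⟨b, d, hd, rfl⟩ := Nat.exists_eq_two_pow_mul_odd hn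
  obtain rfl : a = b := by
    rwa [padicValNat_two_pow_mul_odd hc, padicValNat_two_pow_mul_odd hd] at h
  have hcd : c + d ≠ 0 := (Nat.add_pos_left hc.pos d).ne'
  have := one_le_padicValNat_of_dvd hcd (hc.add_odd hd).two_dvd
  rw [← mul_add, padicValNat.mul (by positivity) hcd, padicValNat.prime_pow,
    padicValNat_two_pow_mul_odd hc]
  lia

theorem padicValNat_sub_eq_of_lt {p : ℕ} [Fact p.Prime] {m n : ℕ} (hm : m ≠ 0) (hmn : m < n)
    (h : padicValNat p m < padicValNat p n) : padicValNat p (n - m) = padicValNat p m := by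
  have hne : -(m : ℚ) + n ≠ 0 := by
    rw [neg_add_eq_sub, sub_ne_zero]
    exact_mod_cast hmn.ne'
  have hval := padicValRat.add_eq_of_lt (p := p) hne (by simpa using hm)
    (by exact_mod_cast (Nat.zero_le m).trans_lt hmn |>.ne') (by simpa using h)
  rw [neg_add_eq_sub, ← Nat.cast_sub hmn.le] at hval
  simpa using hval

/-- The numbers of 2-adic valuation `a`. These classes partition `ω` (with `0` in class `0`, as
`padicValNat 2 0 = 0`), and are put into an almost disjoint family `𝒜` to prevent `posDiffs F` from
being contained in a member of `𝒜`. -/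
def valuationClass (a : ℕ) : Set ℕ := {n | padicValNat 2 n = a}

theorem infinite_valuationClass (a : ℕ) : (valuationClass a).Infinite := by
  refine Set.infinite_of_injective_forall_mem (f := fun k => 2 ^ a * (2 * k + 1)) ?_
    fun k => padicValNat_two_pow_mul_odd (odd_two_mul_add_one k) a
  intro k l h
  have := Nat.eq_of_mul_eq_mul_left (by positivity) h
  lia

theorem valuationClass_injective : valuationClass.Injective := by
  intro a b h
  obtain ⟨n, hn⟩ := (infinite_valuationClass a).nonempty
  exact hn.symm.trans (h ▸ hn : n ∈ valuationClass b)

theorem isAlmostDisjointFamily_range_valuationClass :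
    IsAlmostDisjointFamily (Set.range valuationClass) := by
  refine ⟨Set.forall_mem_range.2 infinite_valuationClass, ?_⟩
  rintro _ ⟨a, rfl⟩ _ ⟨b, rfl⟩ hne
  refine Set.finite_empty.subset ?_
  rintro n ⟨ha, hb⟩
  exact hne (congrArg _ (ha.symm.trans hb))

variable {F : Set ℕ}

theorem not_posDiffs_subset_valuationClass (hF : F.Infinite) (a : ℕ) :
    ¬ posDiffs F ⊆ valuationClass a := by
  intro h
  obtain ⟨x, hx⟩ := hF.nonempty
  obtain ⟨y, hy, hxy⟩ := hF.exists_gt x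
  obtain ⟨z, hz, hyz⟩ := hF.exists_gt y
  have hyx : padicValNat 2 (y - x) = a := h ⟨y, hy, x, hx, hxy, rfl⟩
  have hzy : padicValNat 2 (z - y) = a := h ⟨z, hz, y, hy, hyz, rfl⟩
  have hzx : padicValNat 2 (z - x) = a := h ⟨z, hz, x, hx, hxy.trans hyz, rfl⟩
  have hlt := padicValNat_two_lt_add_of_eq (by lia) (by lia) (hyx.trans hzy.symm)
  rw [add_comm, Nat.sub_add_sub_cancel hyz.le hxy.le] at hlt
  lia

theorem infinite_posDiffs_inter {A : Set ℕ} {d : ℕ} (hd : d ∈ F)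
    (h : {e ∈ F | d < e ∧ e - d ∈ A}.Infinite) : (posDiffs F ∩ A).Infinite := by
  refine (h.image (f := fun e => e - d) fun e he e' he' hee' => ?_).mono ?_
  · exact (tsub_left_inj he.2.1.le he'.2.1.le).1 hee'
  · rintro _ ⟨e, ⟨he, hde, heA⟩, rfl⟩
    exact ⟨⟨e, he, d, hd, hde, rfl⟩, heA⟩

-- For `x < y` in `F` and `b` the valuation of `y - x`: unless infinitely many differences `e - x`
-- have one of the valuations `≤ b`, almost all differences `e - y` have valuation `b`.
theorem exists_infinite_posDiffs_inter_valuationClass (hF : F.Infinite) :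
    ∃ a, (posDiffs F ∩ valuationClass a).Infinite := by
  obtain ⟨x, hx⟩ := hF.nonempty
  obtain ⟨y, hy, hxy⟩ := hF.exists_gt x
  let b := padicValNat 2 (y - x)
  by_cases hsmall : ∃ a ≤ b, {e ∈ F | x < e ∧ e - x ∈ valuationClass a}.Infinite
  · obtain ⟨a, -, ha⟩ := hsmall
    exact ⟨a, infinite_posDiffs_inter hx ha⟩
  push Not at hsmall
  refine ⟨b, infinite_posDiffs_inter hy ?_⟩
  refine (hF.sdiff ((Set.finite_Iic y).union
    ((Set.finite_Iic b).biUnion fun a ha => hsmall a ha))).mono ?_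
  rintro e ⟨he, hne⟩
  have hye : y < e := not_le.1 fun hle => hne (.inl hle)
  have hbe : b < padicValNat 2 (e - x) := not_le.1 fun hle =>
    hne (.inr (Set.mem_biUnion hle ⟨he, hxy.trans hye, rfl⟩))
  refine ⟨he, hye, ?_⟩
  rw [← Nat.sub_sub_sub_cancel_right hxy.le]
  exact padicValNat_sub_eq_of_lt (by lia) (by lia) hbe

theorem IsAlmostDisjointFamily.not_posDiffs_subset {𝒜 : Set (Set ℕ)}
    (h𝒜 : IsAlmostDisjointFamily 𝒜) (hval : ∀ a, valuationClass a ∈ 𝒜) (hF : F.Infinite)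
    {A : Set ℕ} (hA : A ∈ 𝒜) : ¬ posDiffs F ⊆ A := by
  intro hsub
  obtain ⟨a, ha⟩ := exists_infinite_posDiffs_inter_valuationClass hF
  have hAa : A ≠ valuationClass a := fun h => not_posDiffs_subset_valuationClass hF a (h ▸ hsub)
  exact ha ((h𝒜.2 A hA _ (hval a) hAa).subset (Set.inter_subset_inter_left _ hsub))

theorem exists_tendsto_forall_eventually_mem_posDiffs (hF : F.Infinite) :
    ∃ v : ℕ → ℕ, Tendsto v atTop atTop ∧
      ∀ K : Set ℕ, K.Finite → ∀ᶠ n in atTop, v n ∈ posDiffs (F \ K) := by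
  let e := Nat.nth (· ∈ F)
  have he : StrictMono e := Nat.nth_strictMono hF
  have heF (n : ℕ) : e n ∈ F := Nat.nth_mem_of_infinite hF n
  have hgap (n : ℕ) : n ≤ e (2 * n + 1) - e n := by
    have := he.add_le_nat (n + 1) n
    rw [show n + 1 + n = 2 * n + 1 by ring] at this
    lia
  refine ⟨fun n => e (2 * n + 1) - e n, tendsto_atTop_mono hgap tendsto_id, fun K hK => ?_⟩
  have hek : ∀ᶠ k in atTop, e k ∉ K := by
    rw [← Nat.cofinite_eq_atTop]
    exact he.injective.tendsto_cofinite.eventually hK.eventually_cofinite_notMem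
  have hodd : Tendsto (fun n => 2 * n + 1) atTop atTop :=
    tendsto_atTop_mono (fun n => show n ≤ 2 * n + 1 by lia) tendsto_id
  filter_upwards [hek, hodd.eventually hek] with n hn hn'
  exact ⟨_, ⟨heF _, hn'⟩, _, ⟨heF n, hn⟩, he (by lia), rfl⟩

theorem FranklinSpace.not_diffCompactSpace {𝒜 : Set (Set ℕ)} (h𝒜 : IsMADFamily 𝒜)
    (hval : ∀ a, valuationClass a ∈ 𝒜) : ¬ DiffCompactSpace (FranklinSpace 𝒜) := by
  intro hX
  have := t2Space h𝒜.1
  obtain ⟨F, hF, x, hFx⟩ := hX (point : ℕ → FranklinSpace 𝒜)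
  obtain ⟨v, hv, hvF⟩ := exists_tendsto_forall_eventually_mem_posDiffs hF
  replace hv : Tendsto v atTop cofinite := hv.mono_right Nat.cofinite_eq_atTop.ge
  obtain ⟨A, hA, φ, hφ, hvA⟩ := h𝒜.exists_strictMono_forall_mem hv
  have hlimA : Tendsto (fun n => point (v (φ n))) atTop (𝓝 (member ⟨A, hA⟩)) :=
    tendsto_member (.of_forall hvA) (hv.comp hφ.tendsto_atTop)
  have hlimx : Tendsto (fun n => (point (v (φ n)) : FranklinSpace 𝒜)) atTop (𝓝 x) := by
    refine tendsto_nhds.2 fun U hUo hxU => ?_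
    obtain ⟨K, hK, hKU⟩ := hFx U (hUo.mem_nhds hxU)
    filter_upwards [hφ.tendsto_atTop.eventually (hvF K hK)] with n hn
    exact hKU ⟨_, hn, rfl⟩
  obtain rfl := tendsto_nhds_unique hlimx hlimA
  obtain ⟨K, hK, hKA⟩ := exists_finite_subset_of_rhoConverges_member hFx
  exact h𝒜.1.not_posDiffs_subset hval (hF.sdiff hK) hA hKA

end Valuation

section Captures

variable {Λ : Type u} {I : Set (Set Λ)}

/-- The requirement that a map `f : L → ω` imposes on an almost disjoint family `𝒜` on `ω` for
`Φ(𝒜)` to be in `FinBW(I)`: if `f` has fibres in `I` and `I` restricted to `L` is not Katětov above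
`BI`, then `f` maps some `I`-positive set in a finite-to-one way into a member of `𝒜`. -/
def Captures (I : Set (Set Λ)) (L : Set Λ) (f : Λ → ℕ) (𝒜 : Set (Set ℕ)) : Prop :=
  ¬ KatetovLEOn BI I L → (∀ n, L ∩ f ⁻¹' {n} ∈ I) →
    ∃ B ⊆ L, B ∉ I ∧ Tendsto (B.domRestrict f) cofinite cofinite ∧ ∃ A ∈ 𝒜, f '' B ⊆ A

theorem Captures.monotone (L : Set Λ) (f : Λ → ℕ) : Monotone (Captures I L f) := by
  intro 𝒜 ℬ h𝒜ℬ h hL hf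
  obtain ⟨B, hBL, hB, hfB, A, hA, hBA⟩ := h hL hf
  exact ⟨B, hBL, hB, hfB, A, h𝒜ℬ hA, hBA⟩

theorem IsIdealOn.exists_captures_insert [Countable Λ] (hI : IsIdealOn I) {L : Set Λ} {f : Λ → ℕ}
    {𝒜 : Set (Set ℕ)} (h𝒜 : IsAlmostDisjointFamily 𝒜) (h𝒜c : 𝒜.Countable)
    (hcov : ⋃₀ 𝒜 = Set.univ) :
    ∃ A, IsAlmostDisjointFamily (insert A 𝒜) ∧ Captures I L f (insert A 𝒜) := by
  classical
  obtain ⟨A₀, hA₀, -⟩ := Set.sUnion_eq_univ_iff.1 hcov 0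
  by_cases hLf : ¬ KatetovLEOn BI I L ∧ ∀ n, L ∩ f ⁻¹' {n} ∈ I
  swap
  · exact ⟨A₀, by rwa [Set.insert_eq_of_mem hA₀], fun hL hf => absurd ⟨hL, hf⟩ hLf⟩
  obtain ⟨A, rfl⟩ := h𝒜c.exists_eq_range ⟨A₀, hA₀⟩
  have hmem (m : ℕ) : ∃ n, m ∈ A n := by simpa using Set.sUnion_eq_univ_iff.1 hcov m
  obtain ⟨B, hBL, hB, hfB, hrB⟩ := hI.exists_tendsto_cofinite_of_not_katetovLEOn hLf.1 hLf.2
    fun m => Nat.find (hmem m)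
  obtain ⟨C, hCB, hC, ⟨n, hn⟩ | had⟩ := hI.exists_subset_image_subset_or_almostDisjoint hB
    (fun m => Nat.find_spec (hmem m)) (fun n m hm => Nat.find_min' (hmem m) hm) hrB
  · refine ⟨A n, by rwa [Set.insert_eq_of_mem (Set.mem_range_self n)], fun _ _ => ?_⟩
    exact ⟨C, hCB.trans hBL, hC, tendsto_domRestrict_mono hfB hCB, A n, .inl rfl, hn⟩
  · have hfC := tendsto_domRestrict_mono hfB hCB
    refine ⟨f '' C, h𝒜.insert (infinite_image_of_tendsto_cofinite (hI.infinite_of_notMem hC) hfC)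
      (Set.forall_mem_range.2 had), fun _ _ => ?_⟩
    exact ⟨C, hCB.trans hBL, hC, hfC, f '' C, .inl rfl, subset_rfl⟩

theorem IsIdealOn.exists_isMADFamily_forall_captures
    (hCH : Cardinal.continuum.{0} = Cardinal.aleph.{0} 1) [Countable Λ] (hI : IsIdealOn I)
    {ℰ : Set (Set ℕ)} (hℰ : IsAlmostDisjointFamily ℰ) (hℰc : ℰ.Countable)
    (hcov : ⋃₀ ℰ = Set.univ) :
    ∃ 𝒜, ℰ ⊆ 𝒜 ∧ IsMADFamily 𝒜 ∧ ∀ L f, Captures I L f 𝒜 := by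
  have hT : Cardinal.mk (Set Λ × (Λ → ℕ)) ≤ Cardinal.aleph 1 := by
    have hCH' : Cardinal.continuum.{u} = Cardinal.aleph 1 := by
      simpa using congrArg Cardinal.lift.{u} hCH
    have hset : Cardinal.mk (Set Λ) ≤ Cardinal.continuum := by
      rw [Cardinal.mk_set, ← Cardinal.two_power_aleph0]
      exact Cardinal.power_le_power_left two_ne_zero Cardinal.mk_le_aleph0
    have hfun : Cardinal.mk (Λ → ℕ) ≤ Cardinal.continuum := by
      rw [Cardinal.mk_arrow, Cardinal.mk_nat, Cardinal.lift_aleph0, Cardinal.lift_uzero,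
        ← Cardinal.aleph0_power_aleph0]
      exact Cardinal.power_le_power_left Cardinal.aleph0_ne_zero Cardinal.mk_le_aleph0
    rw [← hCH', Cardinal.mk_prod, Cardinal.lift_id, Cardinal.lift_id,
      ← Cardinal.continuum_mul_self]
    exact mul_le_mul' hset hfun
  obtain ⟨𝒜, hℰ𝒜, h𝒜, hcap⟩ := exists_forall_of_countable_extensions hT
    (Q := fun t => Captures I t.1 t.2) (fun _ => .sUnion) (fun t => Captures.monotone t.1 t.2)
    hℰc hℰ fun t ℬ hℰℬ hℬc hℬ =>
      have ⟨A, hA, hAcap⟩ := hI.exists_captures_insert hℬ hℬc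
        (Set.univ_subset_iff.1 (hcov.ge.trans (Set.sUnion_subset_sUnion hℰℬ)))
      ⟨insert A ℬ, Set.subset_insert A ℬ, hℬc.insert A, hA, hAcap⟩
  obtain ⟨ℬ, h𝒜ℬ, hℬ⟩ := h𝒜.exists_isMADFamily
  exact ⟨ℬ, hℰ𝒜.trans h𝒜ℬ, hℬ, fun L f => Captures.monotone L f h𝒜ℬ (hcap (L, f))⟩

end Captures

section FinBW

variable {Λ : Type u} {I : Set (Set Λ)} {𝒜 : Set (Set ℕ)} {f : Λ → FranklinSpace 𝒜} {L : Set Λ}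

theorem exists_tendsto_of_captures (hI : IsIdealOn I) (hL : ¬ KatetovLEOn BI I L)
    (hcap : ∀ g, Captures I L g 𝒜) (hfib : ∀ x, f ⁻¹' {x} ∈ I)
    (hfL : ∀ l ∈ L, f l ∈ Set.range FranklinSpace.point) :
    ∃ B ∉ I, ∃ x, Tendsto (B.domRestrict f) cofinite (𝓝 x) := by
  let g : Λ → ℕ := Function.invFun FranklinSpace.point ∘ f
  have hfg {l : Λ} (hl : l ∈ L) : FranklinSpace.point (g l) = f l := Function.invFun_eq (hfL l hl)
  obtain ⟨B, hBL, hB, hgB, A, hA, hBA⟩ := hcap g hL fun n =>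
    hI.subset_mem _ _ (hfib (FranklinSpace.point n)) fun l ⟨hl, hgl⟩ => by
      rw [Set.mem_preimage, ← hfg hl, hgl, Set.mem_singleton_iff]
  have hlim : Tendsto (fun l => FranklinSpace.point (B.domRestrict g l)) cofinite
      (𝓝 (FranklinSpace.member ⟨A, hA⟩)) :=
    FranklinSpace.tendsto_member (.of_forall fun l => hBA ⟨l, l.2, rfl⟩) hgB
  exact ⟨B, hB, _, hlim.congr fun l => hfg (hBL l.2)⟩

theorem exists_tendsto_infty [Countable Λ] (hI : IsIdealOn I) (hL : ¬ KatetovLEOn BI I L)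
    (hfib : ∀ x, f ⁻¹' {x} ∈ I) (hfL : ∀ l ∈ L, f l ∉ Set.range FranklinSpace.point) :
    ∃ B ∉ I, Tendsto (B.domRestrict f) cofinite (𝓝 OnePoint.infty) := by
  obtain ⟨ν, hν⟩ := Set.countable_iff_exists_injOn.1 (Set.countable_range f)
  have hνfib (n : ℕ) : L ∩ (ν ∘ f) ⁻¹' {n} ∈ I := by
    rcases (L ∩ (ν ∘ f) ⁻¹' {n}).eq_empty_or_nonempty with hempty | ⟨l, -, rfl⟩
    · exact hempty ▸ hI.finite_mem ∅ Set.finite_empty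
    · exact hI.subset_mem _ _ (hfib (f l)) fun a ha => hν ⟨a, rfl⟩ ⟨l, rfl⟩ ha.2
  obtain ⟨B, hBL, hB, hνB, -⟩ :=
    hI.exists_tendsto_cofinite_of_not_katetovLEOn hL hνfib fun _ => 0
  refine ⟨B, hB, FranklinSpace.tendsto_infty (.of_forall fun l => hfL l (hBL l.2)) ?_⟩
  refine tendsto_domRestrict_cofinite_cofinite fun x => ?_
  refine (tendsto_domRestrict_cofinite_iff.1 hνB _
    (Set.finite_singleton (ν x)).compl_mem_cofinite).subset ?_
  rintro l ⟨hl, rfl⟩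
  exact ⟨hl, fun h => h rfl⟩

theorem FranklinSpace.finBW [Countable Λ] (hI : IsIdealOn I) (hBI : ¬ KatetovLE BI I)
    (hcap : ∀ L g, Captures I L g 𝒜) : FinBW I (FranklinSpace 𝒜) := by
  intro f
  by_cases hfib : ∀ x, f ⁻¹' {x} ∈ I
  swap
  · push Not at hfib
    obtain ⟨x, hx⟩ := hfib
    exact ⟨_, hx, x, tendsto_const_nhds.congr fun l => l.2.symm⟩
  by_cases hL : KatetovLEOn BI I (f ⁻¹' Set.range point)
  · have hLc : ¬ KatetovLEOn BI I (f ⁻¹' Set.range point)ᶜ := fun hLc =>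
      hBI (hL.katetovLE hI (fun _ _ => mem_BI_of_subset) hLc)
    obtain ⟨B, hB, hlim⟩ := exists_tendsto_infty hI hLc hfib fun _ => id
    exact ⟨B, hB, _, hlim⟩
  · exact exists_tendsto_of_captures hI hL (hcap _) hfib fun _ => id

end FinBW

section Main

variable {Λ : Type u} {I : Set (Set Λ)}

theorem exists_isMADFamily_separating (hCH : Cardinal.continuum.{0} = Cardinal.aleph.{0} 1)
    [Countable Λ] (hI : IsIdealOn I) (hBI : ¬ KatetovLE BI I) :
    ∃ 𝒜 : Set (Set ℕ), 𝒜.Infinite ∧ IsMADFamily 𝒜 ∧ FinBW I (FranklinSpace 𝒜) ∧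
      ¬ DiffCompactSpace (FranklinSpace 𝒜) := by
  have hcov : ⋃₀ Set.range valuationClass = Set.univ :=
    Set.sUnion_eq_univ_iff.2 fun n => ⟨_, ⟨padicValNat 2 n, rfl⟩, rfl⟩
  obtain ⟨𝒜, hval, h𝒜, hcap⟩ := hI.exists_isMADFamily_forall_captures hCH
    isAlmostDisjointFamily_range_valuationClass (Set.countable_range _) hcov
  exact ⟨𝒜, (Set.infinite_range_of_injective valuationClass_injective).mono hval, h𝒜,
    FranklinSpace.finBW hI hBI hcap,
    FranklinSpace.not_diffCompactSpace h𝒜 (Set.range_subset_iff.1 hval)⟩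

theorem not_katetovLE_BI_iff_exists_not_finBWRho
    (hCH : Cardinal.continuum.{0} = Cardinal.aleph.{0} 1) [Countable Λ] (hI : IsIdealOn I)
    {Γ : Type*} {ρ : Set ℕ → Set Γ}
    (hBIρ : ∀ (X : Type v) [TopologicalSpace X] [T2Space X], FinBW BI X → FinBWRho ρ X)
    (hρ : ∀ (X : Type v) [TopologicalSpace X], FinBWRho ρ X → DiffCompactSpace X) :
    ¬ KatetovLE BI I ↔
      ∃ (X : Type v) (_ : TopologicalSpace X), T2Space X ∧ FinBW I X ∧ ¬ FinBWRho ρ X := by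
  refine ⟨fun hBI => ?_, fun ⟨X, _, _, hX, hXρ⟩ hBI => hXρ (hBIρ X (hX.of_katetovLE hBI))⟩
  obtain ⟨𝒜, -, h𝒜, hX, hXdiff⟩ := exists_isMADFamily_separating hCH hI hBI
  have := FranklinSpace.t2Space h𝒜.1
  exact ⟨ULift (FranklinSpace 𝒜), inferInstance, inferInstance, hX.homeomorph Homeomorph.ulift.symm,
    fun hXρ => hXdiff ((hρ _ hXρ).homeomorph Homeomorph.ulift)⟩

end Main

theorem mainTheorem12
    (hCH : Cardinal.continuum.{0} = Cardinal.aleph.{0} 1)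
    {Λ : Type u} [Countable Λ] [Infinite Λ] (I : Set (Set Λ)) (hI : IsIdealOn I) :
    (¬ KatetovLE BI I ↔
      ∃ (X : Type v) (_ : TopologicalSpace X), T2Space X ∧ FinBW I X ∧ ¬ HindmanSpace X) ∧
    (¬ KatetovLE BI I ↔
      ∃ (X : Type v) (_ : TopologicalSpace X), T2Space X ∧ FinBW I X ∧ ¬ RamseySpace X) ∧
    (¬ KatetovLE BI I ↔
      ∃ (X : Type v) (_ : TopologicalSpace X), T2Space X ∧ FinBW I X ∧ ¬ DiffCompactSpace X) ∧
    (¬ KatetovLE BI I →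
      ∃ 𝒜 : Set (Set ℕ), 𝒜.Infinite ∧ IsMADFamily 𝒜 ∧
        T2Space (FranklinSpace 𝒜) ∧ CompactSpace (FranklinSpace 𝒜) ∧
        TopologicalSpace.SeparableSpace (FranklinSpace 𝒜) ∧
        Cardinal.mk (FranklinSpace 𝒜) = Cardinal.continuum ∧
        FinBW I (FranklinSpace 𝒜) ∧ ¬ HindmanSpace (FranklinSpace 𝒜) ∧
        ¬ RamseySpace (FranklinSpace 𝒜) ∧ ¬ DiffCompactSpace (FranklinSpace 𝒜)) := by
  refine ⟨not_katetovLE_BI_iff_exists_not_finBWRho hCH hI (fun _ _ _ => FinBW.hindmanSpace)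
      fun _ _ => HindmanSpace.diffCompactSpace,
    not_katetovLE_BI_iff_exists_not_finBWRho hCH hI (fun _ _ _ => FinBW.ramseySpace)
      fun _ _ => RamseySpace.diffCompactSpace,
    not_katetovLE_BI_iff_exists_not_finBWRho hCH hI
      (fun _ _ _ hX => hX.ramseySpace.diffCompactSpace) fun _ _ => id, fun hBI => ?_⟩
  obtain ⟨𝒜, hinf, h𝒜, hX, hXdiff⟩ := exists_isMADFamily_separating hCH hI hBI
  exact ⟨𝒜, hinf, h𝒜, FranklinSpace.t2Space h𝒜.1, inferInstance,
    FranklinSpace.separableSpace h𝒜.1.1,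
    (FranklinSpace.mk_eq hinf).trans (h𝒜.mk_eq_continuum hCH hinf), hX,
    mt HindmanSpace.diffCompactSpace hXdiff, mt RamseySpace.diffCompactSpace hXdiff, hXdiff⟩
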